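/- Let $m=m_\nu$ and $n=n_\nu$ be positive integers tending to infinity with $m/n\to\beta$ for some $\beta>0$, and for each $\nu$ let $P=P_\nu$ be a probability distribution on $\{0,1,\dots,m\}$. Let $W=\{w_1,\dots,w_m\}$ and let $D_1,\dots,D_n$ be independent random subsets of $W$ with $\mathbb P(D_i=A)=P(|A|)\binom{m}{|A|}^{-1}$ for $A\subset W$; put $X_i=|D_i|$, so that $X_i$ has distribution $P$. The passive random intersection graph $G^*_1(n,m,P)$ has vertex set $W$, and two distinct vertices $w,w'$ are adjacent ($w\sim w'$) if and only if $\{w,w'\}\subset D_i$ for some $i$. Let $d(w)$ be the degree of $w$, and let $$\alpha^{*[k]}(n,m,P)=\mathbb P\bigl(w_2\sim w_3\mid w_1\sim w_2,\ w_1\sim w_3,\ d(w_1)=k\bigr).$$ Assume that $X_1$ converges in distribution to a random variable $Z$ with $\mathbb E Z^3<\infty$, $\mathbb P(Z\ge 2)>0$, and $\mathbb E X_1^3\to\mathbb E Z^3$. Let $\tilde Z_1,\tilde Z_2,\dots$ be independent random variables with $\mathbb P(\tilde Z_i=j)=(j+1)\,\mathbb P(Z=j+1)/\mathbb E Z$ for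 $j=0,1,2,\dots$, and let $\Lambda$ be a Poisson random variable with mean $\beta^{-1}\mathbb E Z$, independent of the sequence $(\tilde Z_i)_{i\ge1}$. With $(x)_2=x(x-1)$, put $$d_*=\sum_{j=1}^{\Lambda}\tilde Z_j,\qquad d_{2*}=\sum_{j=1}^{\Lambda}(\tilde Z_j)_2 .$$ Then for every integer $k\ge 2$ with $\mathbb P(d_*=k)>0$, the event conditioned on in $\alpha^{*[k]}(n,m,P)$ has positive probability for all large $\nu$, and $$\alpha^{*[k]}(n,m,P)=\frac{1}{k(k-1)}\,\mathbb E\bigl(d_{2*}\mid d_*=k\bigr)+o(1)\qquad\text{as }\nu\to\infty .$$ -/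

import Mathlib

open MeasureTheory ProbabilityTheory Filter Topology

noncomputable section

namespace PassiveGraph

/-- The masses `P(|A|) / (m choose |A|)`, `A ⊆ W`, add up to one. -/
theorem sum_setLaw (m : ℕ) (P : PMF (Fin (m + 1))) :
    ∑ A : Finset (Fin m),
      P ⟨A.card, Nat.lt_succ_of_le (card_finset_fin_le A)⟩ / (m.choose A.card : ENNReal) = 1 := by
  classical
  set f : ℕ → ENNReal := fun j =>
    (if h : j < m + 1 then P ⟨j, h⟩ else 0) / (m.choose j : ENNReal) with hf
  have h1 : ∀ A : Finset (Fin m),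
      P ⟨A.card, Nat.lt_succ_of_le (card_finset_fin_le A)⟩ / (m.choose A.card : ENNReal)
        = f A.card := by
    intro A
    have hA : A.card < m + 1 := Nat.lt_succ_of_le (card_finset_fin_le A)
    simp only [hf, dif_pos hA]
  have h2 := Finset.sum_powerset_apply_card f (x := (Finset.univ : Finset (Fin m)))
  rw [Finset.powerset_univ, Finset.card_univ, Fintype.card_fin] at h2
  rw [Finset.sum_congr rfl (fun A _ => h1 A), h2, Finset.sum_range, ← P.tsum_coe, tsum_fintype]
  refine Finset.sum_congr rfl fun i _ => ?_
  have hc : (m.choose (i : ℕ) : ENNReal) ≠ 0 := by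
    have := Nat.choose_pos (Nat.lt_succ_iff.mp i.2)
    exact_mod_cast this.ne'
  simp only [hf, i.2, dif_pos, nsmul_eq_mul]
  exact ENNReal.mul_div_cancel hc (ENNReal.natCast_ne_top _)

/-- The law of a random subset `D` of `W = Fin m` whose size has distribution `P` and which is
uniformly distributed given its size: `ℙ(D = A) = P(|A|) / (m choose |A|)`. -/
def setLaw (m : ℕ) (P : PMF (Fin (m + 1))) : PMF (Finset (Fin m)) :=
  PMF.ofFintype
    (fun A => P ⟨A.card, Nat.lt_succ_of_le (card_finset_fin_le A)⟩ / (m.choose A.card : ENNReal))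
    (sum_setLaw m P)

/-- The joint law of `n` independent random subsets `D₁, …, Dₙ` of `W = Fin m`, each with law
`setLaw m P`. -/
def setsLaw (n m : ℕ) (P : PMF (Fin (m + 1))) : Measure (Fin n → Finset (Fin m)) :=
  Measure.pi fun _ => (setLaw m P).toMeasure

/-- The passive intersection graph of the sets `D₁, …, Dₙ` with parameter `s`: two distinct
elements of `W` are adjacent iff both belong to `Dᵢ` for at least `s` indices `i`. -/
def passiveGraph (s : ℕ) {n m : ℕ} (D : Fin n → Finset (Fin m)) : SimpleGraph (Fin m) where
  Adj w w' := w ≠ w' ∧ s ≤ (Finset.univ.filter fun i => w ∈ D i ∧ w' ∈ D i).card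
  symm := ⟨fun w w' h => ⟨h.1.symm, by simpa only [and_comm] using h.2⟩⟩
  loopless := ⟨fun _ h => h.1 rfl⟩

/-- The degree of the vertex `w` in the passive graph. -/
def degree (s : ℕ) {n m : ℕ} (D : Fin n → Finset (Fin m)) (w : Fin m) : ℕ :=
  ((passiveGraph s D).neighborSet w).ncard

/-- The event `w₁ ∼ w₂, w₁ ∼ w₃, d(w₁) = k` in the passive graph with `s = 1`. -/
def cherryEvent (n m k : ℕ) (w₁ w₂ w₃ : Fin m) : Set (Fin n → Finset (Fin m)) :=
  {D | (passiveGraph 1 D).Adj w₁ w₂ ∧ (passiveGraph 1 D).Adj w₁ w₃ ∧ degree 1 D w₁ = k}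

/-- The degree-conditioned clustering coefficient of the random graph `G*₁(n, m, P)`: the
conditional probability `ℙ(w₂ ∼ w₃ | w₁ ∼ w₂, w₁ ∼ w₃, d(w₁) = k)`. -/
def clustering (n m : ℕ) (P : PMF (Fin (m + 1))) (k : ℕ) (w₁ w₂ w₃ : Fin m) : ℝ :=
  (cond (setsLaw n m P) (cherryEvent n m k w₁ w₂ w₃)).real {D | (passiveGraph 1 D).Adj w₂ w₃}

/-- The sequence `q̃` associated with a sequence of probabilities `q` with mean `μ = ∑ j q_j`:
`q̃_j = (j + 1) q_{j+1} / μ` if `μ ≠ 0`, and the unit mass at `0` if `μ = 0`. -/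
def sizeBiased (q : ℕ → ℝ) (j : ℕ) : ℝ :=
  if ∑' i : ℕ, (i : ℝ) * q i = 0 then (if j = 0 then 1 else 0)
  else ((j : ℝ) + 1) * q (j + 1) / ∑' i : ℕ, (i : ℝ) * q i

end PassiveGraph

end

/-!
Fix `w₁`. By exchangeability of the vertices, averaging over the pair `(w₂, w₃)` shows that the
clustering coefficient is the ratio `E[N; d(w₁) = k] / (k (k - 1) ℙ(d(w₁) = k))`, where `N` is the
number of ordered pairs of adjacent neighbours of `w₁` (`clustering_eq`).

Let the block of `Dᵢ` be `Dᵢ \ {w₁}` if `w₁ ∈ Dᵢ` and empty otherwise, and let `Yᵢ` be its size.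
The `Yᵢ` are independent with the common law `blockLaw`. Unless two sets share an edge at `w₁`
(`doubleEdge`), or the edges of a triangle at `w₁` come from three different sets
(`mixedTriangle`), one has `d(w₁) = ∑ Yᵢ` and `N = ∑ (Yᵢ)₂`. Two given vertices lie in a random set
with probability `O(m⁻²)`, so by the union bound the exceptional events have probability `O(m⁻¹)`,
uniformly in `w₁`.

It remains to find the limits of `ℙ(∑ Yᵢ = k)` and `E[∑ (Yᵢ)₂; ∑ Yᵢ = k]`. Singling out one summand
(`setIntegral_sum_apply_eq`) reduces the second quantity to the first, and the Palm formula
`setIntegral_sum_range_poisson` does the same for the compound Poisson sum `d_*`. Both laws satisfy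
Panjer's recursion, which expresses the mass at `k + 1` through the masses at `0, …, k`; hence the
convergence `ℙ(∑ Yᵢ = k) → ℙ(d_* = k)` follows by induction on `k` (`tendsto_coeff_mk_pow`) once
`n ℙ(Yᵢ = j)` converges for each `j ≥ 1` and `n ℙ(Yᵢ ≠ 0)` converges. The former limits are the
convergence in distribution of `X₁`, the latter also needs `E X₁ → E Z`, for which the bounded third
moments provide uniform integrability (`tendsto_integral_nat`).
-/

namespace PassiveGraph

/-! ### Sums of independent variables and compound Poisson limits -/

section Compound

variable {Ω ι : Type*} [MeasurableSpace Ω] {μ : Measure Ω}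
  {Y : ι → Ω → ℕ} {p : ℕ → ℝ}

theorem measureReal_and_sum_eq (hY : ∀ i, Measurable (Y i)) (hind : iIndepFun Y μ)
    (hp : ∀ i j, μ.real {ω | Y i ω = j} = p j) {s : Finset ι} {a : ι} (ha : a ∉ s) (j l : ℕ) :
    μ.real {ω | Y a ω = j ∧ ∑ i ∈ s, Y i ω = l}
      = p j * μ.real {ω | ∑ i ∈ s, Y i ω = l} := by
  have h := (hind.indepFun_finsetSum_of_notMem hY ha).symm
  have h2 := h.measure_inter_preimage_eq_mul {j} {l} (measurableSet_singleton _)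
    (measurableSet_singleton _)
  have e1 : {ω | Y a ω = j ∧ ∑ i ∈ s, Y i ω = l}
      = Y a ⁻¹' {j} ∩ (∑ i ∈ s, Y i) ⁻¹' {l} := by
    ext ω; simp
  have e2 : {ω | ∑ i ∈ s, Y i ω = l} = (∑ i ∈ s, Y i) ⁻¹' {l} := by
    ext ω; simp
  rw [e1, e2, measureReal_def, h2, ENNReal.toReal_mul, ← hp a j]
  rfl

variable [IsProbabilityMeasure μ]

/-- The law of a sum of independent `ℕ`-valued variables with common masses `p`: its generating
function is a power of the generating function of `p`. -/
theorem measureReal_sum_eq_coeff (hY : ∀ i, Measurable (Y i)) (hind : iIndepFun Y μ)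
    (hp : ∀ i j, μ.real {ω | Y i ω = j} = p j) (s : Finset ι) (k : ℕ) :
    μ.real {ω | ∑ i ∈ s, Y i ω = k} = PowerSeries.coeff k (PowerSeries.mk p ^ s.card) := by
  classical
  induction s using Finset.induction_on generalizing k with
  | empty =>
    by_cases hk : k = 0
    · subst hk; simp
    · simp [hk, Ne.symm hk, PowerSeries.coeff_one]
  | insert a s ha ih =>
    have hS : Measurable fun ω => ∑ i ∈ s, Y i ω := Finset.measurable_fun_sum s fun i _ => hY i
    have e : {ω | ∑ i ∈ insert a s, Y i ω = k} = ⋃ x ∈ Finset.HasAntidiagonal.antidiagonal k,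
        {ω | Y a ω = x.1 ∧ ∑ i ∈ s, Y i ω = x.2} := by
      ext ω
      simp [Finset.sum_insert ha, Finset.HasAntidiagonal.mem_antidiagonal]
    rw [e, measureReal_biUnion_finset, Finset.card_insert_of_notMem ha, pow_succ',
      PowerSeries.coeff_mul]
    · refine Finset.sum_congr rfl fun x _ => ?_
      rw [measureReal_and_sum_eq hY hind hp ha, ih, PowerSeries.coeff_mk]
    · intro x _ y _ hxy
      refine Set.disjoint_left.2 fun ω h1 h2 => hxy ?_
      exact Prod.ext (h1.1.symm.trans h2.1) (h1.2.symm.trans h2.2)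
    · exact fun x _ => (measurableSet_eq_fun (hY a) measurable_const).inter
        (measurableSet_eq_fun hS measurable_const)

/-- The weight of an additive functional of the summands on the event that the sum is `k`: single
out one summand, whose value is `x.1`; the others add up to `x.2`. -/
theorem setIntegral_sum_apply_eq (hY : ∀ i, Measurable (Y i)) (hind : iIndepFun Y μ)
    (hp : ∀ i j, μ.real {ω | Y i ω = j} = p j) (φ : ℕ → ℝ) (s : Finset ι) (k : ℕ) :
    ∫ ω in {ω | ∑ i ∈ s, Y i ω = k}, ∑ i ∈ s, φ (Y i ω) ∂μ
      = s.card * ∑ x ∈ Finset.HasAntidiagonal.antidiagonal k,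
          φ x.1 * p x.1 * PowerSeries.coeff x.2 (PowerSeries.mk p ^ (s.card - 1)) := by
  classical
  have hm : ∀ t : Finset ι, Measurable fun ω => ∑ i ∈ t, Y i ω :=
    fun t => Finset.measurable_fun_sum t fun i _ => hY i
  have hE : ∀ (a : ι) (t : Finset ι) (x : ℕ × ℕ),
      MeasurableSet {ω | Y a ω = x.1 ∧ ∑ i ∈ t, Y i ω = x.2} := fun a t x =>
    (measurableSet_eq_fun (hY a) measurable_const).inter
      (measurableSet_eq_fun (hm t) measurable_const)
  have key : ∀ a ∈ s, ∀ ω, Set.indicator {ω | ∑ i ∈ s, Y i ω = k} (fun ω => φ (Y a ω)) ω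
      = ∑ x ∈ Finset.HasAntidiagonal.antidiagonal k,
        Set.indicator {ω | Y a ω = x.1 ∧ ∑ i ∈ s.erase a, Y i ω = x.2} (fun _ => φ x.1) ω := by
    intro a ha ω
    have hs : ∑ i ∈ s, Y i ω = Y a ω + ∑ i ∈ s.erase a, Y i ω :=
      (Finset.add_sum_erase s (fun i => Y i ω) ha).symm
    by_cases h : ∑ i ∈ s, Y i ω = k
    · rw [Set.indicator_of_mem (by exact h), Finset.sum_eq_single
        (Y a ω, ∑ i ∈ s.erase a, Y i ω)]
      · simp
      · intro x _ hne
        refine Set.indicator_of_notMem (fun hx => hne ?_) _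
        exact Prod.ext hx.1.symm hx.2.symm
      · intro hn
        exact absurd (Finset.HasAntidiagonal.mem_antidiagonal.2 (hs.symm.trans h)) hn
    · rw [Set.indicator_of_notMem (by exact h), Finset.sum_eq_zero]
      intro x hx
      refine Set.indicator_of_notMem (fun hx' => h ?_) _
      rw [hs, hx'.1, hx'.2, Finset.HasAntidiagonal.mem_antidiagonal.1 hx]
  have hSk : MeasurableSet {ω | ∑ i ∈ s, Y i ω = k} :=
    measurableSet_eq_fun (hm s) measurable_const
  have hint : ∀ a (x : ℕ × ℕ), Integrable
      (Set.indicator {ω | Y a ω = x.1 ∧ ∑ i ∈ s.erase a, Y i ω = x.2} (fun _ => φ x.1)) μ :=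
    fun a x => (integrable_const _).indicator (hE a _ x)
  have h1 : ∫ ω in {ω | ∑ i ∈ s, Y i ω = k}, ∑ i ∈ s, φ (Y i ω) ∂μ
      = ∫ ω, ∑ a ∈ s, ∑ x ∈ Finset.HasAntidiagonal.antidiagonal k,
        Set.indicator {ω | Y a ω = x.1 ∧ ∑ i ∈ s.erase a, Y i ω = x.2} (fun _ => φ x.1) ω ∂μ := by
    rw [← integral_indicator hSk]
    refine integral_congr_ae (Eventually.of_forall fun ω => ?_)
    simp only
    rw [← Finset.sum_congr rfl fun a ha => key a ha ω]
    by_cases h : ω ∈ {ω | ∑ i ∈ s, Y i ω = k}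
    · simp only [Set.indicator_of_mem h]
    · simp only [Set.indicator_of_notMem h, Finset.sum_const_zero]
  rw [h1, integral_finsetSum _ fun a _ => integrable_finsetSum _ fun x _ => hint a x,
    ← nsmul_eq_mul, ← Finset.sum_const]
  refine Finset.sum_congr rfl fun a ha => ?_
  rw [integral_finsetSum _ fun x _ => hint a x]
  refine Finset.sum_congr rfl fun x _ => ?_
  rw [integral_indicator (hE a _ x), setIntegral_const,
    measureReal_and_sum_eq hY hind hp (Finset.notMem_erase a s),
    measureReal_sum_eq_coeff hY hind hp, Finset.card_erase_of_mem ha, smul_eq_mul]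
  ring

end Compound

/-- Panjer's recursion for the coefficients of a power, read off from the derivative
`(f ^ N)' = N f ^ (N - 1) f'`. -/
theorem succ_mul_coeff_mk_pow (p : ℕ → ℝ) (N k : ℕ) :
    ((k : ℝ) + 1) * PowerSeries.coeff (k + 1) (PowerSeries.mk p ^ N)
      = N * ∑ x ∈ Finset.HasAntidiagonal.antidiagonal k, ((x.1 : ℝ) + 1) * p (x.1 + 1)
          * PowerSeries.coeff x.2 (PowerSeries.mk p ^ (N - 1)) := by
  have h := congrArg (PowerSeries.coeff k)
    (Derivation.leibniz_pow (PowerSeries.derivative ℝ) (PowerSeries.mk p) N)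
  rw [PowerSeries.coeff_derivative, map_nsmul, smul_eq_mul, mul_comm (_ ^ _),
    PowerSeries.coeff_mul, nsmul_eq_mul] at h
  rw [mul_comm, h]
  congr 1
  refine Finset.sum_congr rfl fun x _ => ?_
  rw [PowerSeries.coeff_derivative, PowerSeries.coeff_mk]
  ring

theorem tendsto_pow_of_mul_one_sub {ι : Type*} {L : Filter ι} {q : ι → ℝ} {N : ι → ℕ} {c : ℝ}
    (hN : Tendsto N L atTop) (h : Tendsto (fun ν => (N ν : ℝ) * (1 - q ν)) L (𝓝 c)) :
    Tendsto (fun ν => q ν ^ N ν) L (𝓝 (Real.exp (-c))) := by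
  have hN' : Tendsto (fun ν => (N ν : ℝ)) L atTop := tendsto_natCast_atTop_atTop.comp hN
  have h0 : Tendsto (fun ν => 1 - q ν) L (𝓝 0) := by
    have := h.div_atTop hN'
    refine this.congr' ?_
    filter_upwards [hN.eventually_ge_atTop 1] with ν hν
    have : (N ν : ℝ) ≠ 0 := by positivity
    field_simp
  have hq : Tendsto q L (𝓝 1) := by
    have := h0.const_sub 1
    simpa using this
  -- `1 - 1 / q ≤ log q ≤ q - 1`
  have hlog : Tendsto (fun ν => (N ν : ℝ) * Real.log (q ν)) L (𝓝 (-c)) := by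
    have hlow : Tendsto (fun ν => -((N ν : ℝ) * (1 - q ν)) * (q ν)⁻¹) L (𝓝 (-c)) := by
      simpa using h.neg.mul (hq.inv₀ one_ne_zero)
    refine tendsto_of_tendsto_of_tendsto_of_le_of_le' hlow h.neg ?_ ?_
    · filter_upwards [hq.eventually_const_lt (show (0 : ℝ) < 1 by norm_num)] with ν hν
      have := Real.one_sub_inv_le_log_of_pos hν
      have e : -((N ν : ℝ) * (1 - q ν)) * (q ν)⁻¹ = N ν * (1 - (q ν)⁻¹) := by
        field_simp; ring
      rw [e]
      exact mul_le_mul_of_nonneg_left this (Nat.cast_nonneg _)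
    · filter_upwards [hq.eventually_const_lt (show (0 : ℝ) < 1 by norm_num)] with ν hν
      have := Real.log_le_sub_one_of_pos hν
      have h2 := mul_le_mul_of_nonneg_left this (Nat.cast_nonneg (α := ℝ) (N ν))
      linarith
  refine ((Real.continuous_exp.tendsto _).comp hlog).congr' ?_
  filter_upwards [hq.eventually_const_lt (show (0 : ℝ) < 1 by norm_num)] with ν hν
  simp only [Function.comp]
  rw [mul_comm, Real.exp_mul, Real.exp_log hν, Real.rpow_natCast]

theorem tendsto_pred_mul {ι : Type*} {L : Filter ι} {N : ι → ℕ} (hN : Tendsto N L atTop)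
    {a : ι → ℝ} {l : ℝ} (h : Tendsto (fun ν => (N ν : ℝ) * a ν) L (𝓝 l)) :
    Tendsto (fun ν => ((N ν - 1 : ℕ) : ℝ) * a ν) L (𝓝 l) := by
  have ha : Tendsto a L (𝓝 0) := by
    refine (h.div_atTop (tendsto_natCast_atTop_atTop.comp hN)).congr' ?_
    filter_upwards [hN.eventually_ge_atTop 1] with ν hν
    have : (N ν : ℝ) ≠ 0 := by positivity
    simp only [Function.comp]
    field_simp
  have := h.sub ha
  rw [sub_zero] at this
  refine this.congr' ?_
  filter_upwards [hN.eventually_ge_atTop 1] with ν hν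
  rw [Nat.cast_sub hν]
  push_cast
  ring

/-- Convergence of a triangular array of rare summands to a compound Poisson law `π`, the latter
being given by its mass at `0` and Panjer's recursion. -/
theorem tendsto_coeff_mk_pow {ι : Type*} {L : Filter ι} {p : ι → ℕ → ℝ} {lam : ℕ → ℝ} {c : ℝ}
    {π : ℕ → ℝ} (hπ0 : π 0 = Real.exp (-c))
    (hπ : ∀ k : ℕ, ((k : ℝ) + 1) * π (k + 1)
      = ∑ x ∈ Finset.HasAntidiagonal.antidiagonal k, ((x.1 : ℝ) + 1) * lam (x.1 + 1) * π x.2)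
    (k : ℕ) {N : ι → ℕ} (hN : Tendsto N L atTop)
    (h0 : Tendsto (fun ν => (N ν : ℝ) * (1 - p ν 0)) L (𝓝 c))
    (hlam : ∀ j, Tendsto (fun ν => (N ν : ℝ) * p ν (j + 1)) L (𝓝 (lam (j + 1)))) :
    Tendsto (fun ν => PowerSeries.coeff k (PowerSeries.mk (p ν) ^ N ν)) L (𝓝 (π k)) := by
  induction k using Nat.strong_induction_on generalizing N with
  | _ k ih =>
  cases k with
  | zero =>
    rw [hπ0]
    simpa using tendsto_pow_of_mul_one_sub hN h0
  | succ k =>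
    have hsum : Tendsto (fun ν => ∑ x ∈ Finset.HasAntidiagonal.antidiagonal k, ((x.1 : ℝ) + 1) *
        ((N ν : ℝ) * p ν (x.1 + 1)) * PowerSeries.coeff x.2 (PowerSeries.mk (p ν) ^ (N ν - 1))) L
        (𝓝 (∑ x ∈ Finset.HasAntidiagonal.antidiagonal k,
          ((x.1 : ℝ) + 1) * lam (x.1 + 1) * π x.2)) := by
      refine tendsto_finsetSum _ fun x hx => ((hlam x.1).const_mul _).mul ?_
      have hx2 : x.2 < k + 1 := by
        have := Finset.HasAntidiagonal.mem_antidiagonal.1 hx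
        omega
      exact ih x.2 hx2 ((tendsto_sub_atTop_nat 1).comp hN)
        (tendsto_pred_mul hN h0) fun j => tendsto_pred_mul hN (hlam j)
    rw [← hπ] at hsum
    have hk : ((k : ℝ) + 1) ≠ 0 := by positivity
    have := hsum.const_mul ((k : ℝ) + 1)⁻¹
    rw [inv_mul_cancel_left₀ hk] at this
    refine this.congr fun ν => ?_
    rw [inv_mul_eq_iff_eq_mul₀ hk, succ_mul_coeff_mk_pow, Finset.mul_sum]
    refine Finset.sum_congr rfl fun x _ => ?_
    ring

/-! ### Compound Poisson sums -/

section CompoundPoisson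

variable {Ω : Type*} [MeasurableSpace Ω] {μ : Measure Ω} [IsProbabilityMeasure μ]
  {Λ : Ω → ℕ} {Y : ℕ → Ω → ℕ} {r : NNReal} {h : ℕ → ℝ}

/-- Disintegration of a bounded functional of `(Λ, Y)` along the values of `Λ`. -/
theorem hasSum_poisson_mul_integral (hΛm : Measurable Λ) (hY : ∀ i, Measurable (Y i))
    (hΛ : HasLaw Λ (poissonMeasure r) μ) (hΛY : IndepFun Λ (fun ω i => Y i ω) μ)
    {g : ℕ → (ℕ → ℕ) → ℝ} (hg : ∀ i, Measurable (g i)) {C : ℝ} (hC : ∀ i y, |g i y| ≤ C) :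
    HasSum (fun i : ℕ => Real.exp (-r) * r ^ i / i.factorial * ∫ ω, g i (fun j => Y j ω) ∂μ)
      (∫ ω, g (Λ ω) (fun j => Y j ω) ∂μ) := by
  have hYm : Measurable fun ω i => Y i ω := measurable_pi_lambda _ hY
  have hgm : Measurable fun ω => g (Λ ω) (fun j => Y j ω) := by
    have : Measurable fun x : ℕ × (ℕ → ℕ) => g x.1 x.2 := measurable_from_prod_countable_right hg
    exact this.comp (hΛm.prodMk hYm)
  have hint : Integrable (fun ω => g (Λ ω) (fun j => Y j ω)) μ :=
    Integrable.of_bound hgm.aestronglyMeasurable C (Eventually.of_forall fun ω => hC _ _)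
  have hU : (⋃ i, Λ ⁻¹' {i}) = Set.univ := by ext ω; simp
  have hs : ∀ i, MeasurableSet (Λ ⁻¹' {i}) := fun i => hΛm (measurableSet_singleton i)
  have key := hasSum_integral_iUnion (μ := μ) (f := fun ω => g (Λ ω) (fun j => Y j ω))
    (s := fun i => Λ ⁻¹' {i}) hs
    (fun i j hij => Set.disjoint_left.2 fun ω h1 h2 => hij (h1.symm.trans h2)) hint.integrableOn
  rw [hU, setIntegral_univ] at key
  refine key.congr_fun fun i => ?_
  have e1 : ∫ ω in Λ ⁻¹' {i}, g (Λ ω) (fun j => Y j ω) ∂μ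
      = ∫ ω, Set.indicator {i} (fun _ => (1 : ℝ)) (Λ ω) * g i (fun j => Y j ω) ∂μ := by
    rw [← integral_indicator (hs i)]
    refine integral_congr_ae (Eventually.of_forall fun ω => ?_)
    by_cases hω : Λ ω = i
    · simp [Set.indicator, hω]
    · simp [Set.indicator, hω]
  have hind : IndepFun (fun ω => Set.indicator {i} (fun _ => (1 : ℝ)) (Λ ω))
      (fun ω => g i (fun j => Y j ω)) μ :=
    hΛY.comp (φ := Set.indicator {i} (fun _ => (1 : ℝ))) measurable_from_top (hg i)
  have hm1 : Measurable fun ω => Set.indicator {i} (fun _ => (1 : ℝ)) (Λ ω) :=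
    (measurable_from_top (f := Set.indicator ({i} : Set ℕ) (fun _ => (1 : ℝ)))).comp hΛm
  rw [e1, hind.integral_fun_mul_eq_mul_integral hm1.aestronglyMeasurable
    ((hg i).comp hYm).aestronglyMeasurable]
  congr 1
  have e2 : (fun ω => Set.indicator {i} (fun _ => (1 : ℝ)) (Λ ω))
      = Set.indicator (Λ ⁻¹' {i}) (fun _ => (1 : ℝ)) := rfl
  rw [e2, integral_indicator (hs i), setIntegral_const, smul_eq_mul, mul_one,
    ← poissonMeasure_real_singleton]
  exact (hΛ.measureReal_eq (p := fun x => x = i) (measurableSet_singleton i)).symm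

theorem measurable_sum_range {Ω : Type*} [MeasurableSpace Ω] {Λ : Ω → ℕ} {Y : ℕ → Ω → ℕ}
    (hΛm : Measurable Λ) (hY : ∀ i, Measurable (Y i)) :
    Measurable fun ω => ∑ j ∈ Finset.range (Λ ω), Y j ω := by
  have h : Measurable fun x : ℕ × (ℕ → ℕ) => ∑ j ∈ Finset.range x.1, x.2 j :=
    measurable_from_prod_countable_right fun i =>
      Finset.measurable_fun_sum (Finset.range i) fun j _ => measurable_pi_apply j
  exact h.comp (hΛm.prodMk (measurable_pi_lambda _ hY))

/-- The law of a compound Poisson sum is the Poisson mixture of the convolution powers of `h`. -/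
theorem hasSum_poisson_mul_coeff (hΛm : Measurable Λ) (hY : ∀ i, Measurable (Y i))
    (hΛ : HasLaw Λ (poissonMeasure r) μ) (hΛY : IndepFun Λ (fun ω i => Y i ω) μ)
    (hind : iIndepFun Y μ) (hh : ∀ i j, μ.real {ω | Y i ω = j} = h j) (k : ℕ) :
    HasSum (fun i : ℕ => Real.exp (-r) * r ^ i / i.factorial
        * PowerSeries.coeff k (PowerSeries.mk h ^ i))
      (μ.real {ω | ∑ j ∈ Finset.range (Λ ω), Y j ω = k}) := by
  have hset : ∀ i : ℕ, MeasurableSet {y : ℕ → ℕ | ∑ j ∈ Finset.range i, y j = k} := fun i =>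
    measurableSet_eq_fun (Finset.measurable_fun_sum _ fun j _ => measurable_pi_apply j)
      measurable_const
  have key := hasSum_poisson_mul_integral hΛm hY hΛ hΛY
    (g := fun i => Set.indicator {y | ∑ j ∈ Finset.range i, y j = k} fun _ => (1 : ℝ))
    (fun i => measurable_const.indicator (hset i)) (C := 1) (fun i y => by
      by_cases hy : ∑ j ∈ Finset.range i, y j = k <;> simp [Set.indicator, hy])
  have hYm : Measurable fun ω i => Y i ω := measurable_pi_lambda _ hY
  have hlim : ∫ ω, Set.indicator {y : ℕ → ℕ | ∑ j ∈ Finset.range (Λ ω), y j = k}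
      (fun _ => (1 : ℝ)) (fun j => Y j ω) ∂μ
      = μ.real {ω | ∑ j ∈ Finset.range (Λ ω), Y j ω = k} := by
    have hm : MeasurableSet {ω | ∑ j ∈ Finset.range (Λ ω), Y j ω = k} :=
      measurableSet_eq_fun (measurable_sum_range hΛm hY) measurable_const
    rw [← integral_indicator_one hm]
    rfl
  rw [hlim] at key
  refine key.congr_fun fun i => ?_
  have hm : MeasurableSet {ω | ∑ j ∈ Finset.range i, Y j ω = k} := hYm (hset i)
  have := measureReal_sum_eq_coeff hY hind hh (Finset.range i) k
  rw [Finset.card_range, ← integral_indicator_one hm] at this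
  rw [← this]
  rfl

/-- The Palm (Mecke) formula for a compound Poisson sum: singling out one jump of size `x.1`
leaves a copy of the whole sum, with value `x.2`. -/
theorem setIntegral_sum_range_poisson (hΛm : Measurable Λ) (hY : ∀ i, Measurable (Y i))
    (hΛ : HasLaw Λ (poissonMeasure r) μ) (hΛY : IndepFun Λ (fun ω i => Y i ω) μ)
    (hind : iIndepFun Y μ) (hh : ∀ i j, μ.real {ω | Y i ω = j} = h j)
    (φ : ℕ → ℝ) (k : ℕ) {C : ℝ} (hφ : ∀ j ≤ k, |φ j| ≤ C * j) :
    ∫ ω in {ω | ∑ j ∈ Finset.range (Λ ω), Y j ω = k}, ∑ j ∈ Finset.range (Λ ω), φ (Y j ω) ∂μ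
      = r * ∑ x ∈ Finset.HasAntidiagonal.antidiagonal k,
          φ x.1 * h x.1 * μ.real {ω | ∑ j ∈ Finset.range (Λ ω), Y j ω = x.2} := by
  have hset : ∀ i : ℕ, MeasurableSet {y : ℕ → ℕ | ∑ j ∈ Finset.range i, y j = k} := fun i =>
    measurableSet_eq_fun (Finset.measurable_fun_sum _ fun j _ => measurable_pi_apply j)
      measurable_const
  have hYm : Measurable fun ω i => Y i ω := measurable_pi_lambda _ hY
  have hbound : ∀ (i : ℕ) (y : ℕ → ℕ),
      |Set.indicator {y : ℕ → ℕ | ∑ j ∈ Finset.range i, y j = k}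
        (fun y => ∑ j ∈ Finset.range i, φ (y j)) y| ≤ |C| * k := by
    intro i y
    by_cases hy : ∑ j ∈ Finset.range i, y j = k
    · rw [Set.indicator_of_mem (by exact hy)]
      refine (Finset.abs_sum_le_sum_abs _ _).trans ?_
      rw [← hy]
      push_cast
      rw [Finset.mul_sum]
      refine Finset.sum_le_sum fun j hj => (hφ _ ?_).trans ?_
      · rw [← hy]
        exact Finset.single_le_sum (f := y) (fun _ _ => Nat.zero_le _) hj
      · exact mul_le_mul_of_nonneg_right (le_abs_self C) (Nat.cast_nonneg _)
    · rw [Set.indicator_of_notMem (by exact hy), abs_zero]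
      positivity
  have key := hasSum_poisson_mul_integral hΛm hY hΛ hΛY
    (g := fun i => Set.indicator {y | ∑ j ∈ Finset.range i, y j = k}
      fun y => ∑ j ∈ Finset.range i, φ (y j))
    (fun i => (Finset.measurable_fun_sum _ fun j _ =>
      (measurable_from_top (f := φ)).comp (measurable_pi_apply j)).indicator (hset i)) hbound
  have hm : MeasurableSet {ω | ∑ j ∈ Finset.range (Λ ω), Y j ω = k} :=
    measurableSet_eq_fun (measurable_sum_range hΛm hY) measurable_const
  have hlim : ∫ ω, Set.indicator {y : ℕ → ℕ | ∑ j ∈ Finset.range (Λ ω), y j = k}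
      (fun y => ∑ j ∈ Finset.range (Λ ω), φ (y j)) (fun j => Y j ω) ∂μ
      = ∫ ω in {ω | ∑ j ∈ Finset.range (Λ ω), Y j ω = k},
          ∑ j ∈ Finset.range (Λ ω), φ (Y j ω) ∂μ := by
    rw [← integral_indicator hm]
    rfl
  rw [hlim] at key
  have hterm : ∀ i : ℕ, ∫ ω, Set.indicator {y : ℕ → ℕ | ∑ j ∈ Finset.range i, y j = k}
      (fun y => ∑ j ∈ Finset.range i, φ (y j)) (fun j => Y j ω) ∂μ
      = i * ∑ x ∈ Finset.HasAntidiagonal.antidiagonal k,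
          φ x.1 * h x.1 * PowerSeries.coeff x.2 (PowerSeries.mk h ^ (i - 1)) := by
    intro i
    have := setIntegral_sum_apply_eq hY hind hh φ (Finset.range i) k
    rw [Finset.card_range, ← integral_indicator (by exact hYm (hset i))] at this
    rw [← this]
    rfl
  simp only [hterm] at key
  rw [← hasSum_nat_add_iff' 1] at key
  simp only [Finset.range_one, Finset.sum_singleton, Nat.cast_zero, zero_mul, mul_zero,
    sub_zero, Nat.add_sub_cancel] at key
  refine key.unique ?_
  have hx := hasSum_sum (s := Finset.HasAntidiagonal.antidiagonal k)
    fun (x : ℕ × ℕ) _ => (hasSum_poisson_mul_coeff hΛm hY hΛ hΛY hind hh x.2).mul_left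
      (φ x.1 * h x.1)
  refine (hx.mul_left (r : ℝ)).congr_fun fun i => ?_
  rw [Finset.mul_sum, Finset.mul_sum, Finset.mul_sum]
  refine Finset.sum_congr rfl fun x _ => ?_
  have hf : ((i.factorial : ℕ) : ℝ) ≠ 0 := by positivity
  rw [Nat.factorial_succ]
  push_cast
  field_simp
  ring

theorem measureReal_sum_range_poisson_zero (hΛm : Measurable Λ) (hY : ∀ i, Measurable (Y i))
    (hΛ : HasLaw Λ (poissonMeasure r) μ) (hΛY : IndepFun Λ (fun ω i => Y i ω) μ)
    (hind : iIndepFun Y μ) (hh : ∀ i j, μ.real {ω | Y i ω = j} = h j) :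
    μ.real {ω | ∑ j ∈ Finset.range (Λ ω), Y j ω = 0} = Real.exp (-(r * (1 - h 0))) := by
  refine (hasSum_poisson_mul_coeff hΛm hY hΛ hΛY hind hh 0).unique ?_
  have hE := (NormedSpace.expSeries_div_hasSum_exp ((r : ℝ) * h 0)).mul_left (Real.exp (-r))
  rw [← Real.exp_eq_exp_ℝ, ← Real.exp_add] at hE
  rw [show -((r : ℝ) * (1 - h 0)) = -r + r * h 0 by ring]
  refine hE.congr_fun fun i => ?_
  simp [mul_pow]
  ring

/-- Panjer's recursion for a compound Poisson law. -/
theorem succ_mul_measureReal_sum_range_poisson (hΛm : Measurable Λ) (hY : ∀ i, Measurable (Y i))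
    (hΛ : HasLaw Λ (poissonMeasure r) μ) (hΛY : IndepFun Λ (fun ω i => Y i ω) μ)
    (hind : iIndepFun Y μ) (hh : ∀ i j, μ.real {ω | Y i ω = j} = h j) (k : ℕ) :
    ((k : ℝ) + 1) * μ.real {ω | ∑ j ∈ Finset.range (Λ ω), Y j ω = k + 1}
      = ∑ x ∈ Finset.HasAntidiagonal.antidiagonal k, ((x.1 : ℝ) + 1) * (r * h (x.1 + 1))
          * μ.real {ω | ∑ j ∈ Finset.range (Λ ω), Y j ω = x.2} := by
  have hYm : Measurable fun ω i => Y i ω := measurable_pi_lambda _ hY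
  have hm : MeasurableSet {ω | ∑ j ∈ Finset.range (Λ ω), Y j ω = k + 1} :=
    measurableSet_eq_fun (measurable_sum_range hΛm hY) measurable_const
  have key := setIntegral_sum_range_poisson hΛm hY hΛ hΛY hind hh (fun j => (j : ℝ)) (k + 1)
    (C := 1) (fun j _ => by simp)
  have e : ∫ ω in {ω | ∑ j ∈ Finset.range (Λ ω), Y j ω = k + 1},
      ∑ j ∈ Finset.range (Λ ω), (Y j ω : ℝ) ∂μ
      = ∫ ω in {ω | ∑ j ∈ Finset.range (Λ ω), Y j ω = k + 1}, ((k : ℝ) + 1) ∂μ := by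
    refine setIntegral_congr_fun hm fun ω hω => ?_
    have hω' : ∑ j ∈ Finset.range (Λ ω), Y j ω = k + 1 := hω
    rw [← Nat.cast_sum, hω']
    push_cast
    rfl
  rw [e, setIntegral_const, smul_eq_mul, mul_comm] at key
  rw [key, Finset.Nat.antidiagonal_succ, Finset.sum_cons, Finset.sum_map]
  simp only [Nat.cast_zero, zero_mul, zero_add, Finset.mul_sum]
  refine Finset.sum_congr rfl fun x _ => ?_
  simp
  ring

end CompoundPoisson

/-! ### Convergence of the set sizes -/

section Limit

theorem tsum_mul_measureReal_eq_integral {Ω : Type*} [MeasurableSpace Ω] {μ : Measure Ω}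
    {Z : Ω → ℝ} (hZm : AEMeasurable Z μ)
    (hnat : ∀ᵐ ω ∂μ, ∃ l : ℕ, Z ω = l) (hZ : Integrable Z μ) :
    ∑' j : ℕ, (j : ℝ) * μ.real {ω | Z ω = (j : ℝ)} = ∫ ω, Z ω ∂μ := by
  have hN : AEMeasurable (fun ω => ⌊Z ω⌋₊) μ := Nat.measurable_floor.comp_aemeasurable hZm
  have hZN : Z =ᵐ[μ] fun ω => (⌊Z ω⌋₊ : ℝ) := by
    filter_upwards [hnat] with ω ⟨l, hl⟩
    rw [hl, Nat.floor_natCast]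
  have hm : AEStronglyMeasurable (fun n : ℕ => (n : ℝ)) (μ.map fun ω => ⌊Z ω⌋₊) :=
    measurable_from_top.aestronglyMeasurable
  have hint : Integrable (fun n : ℕ => (n : ℝ)) (μ.map fun ω => ⌊Z ω⌋₊) :=
    (integrable_map_measure hm hN).2 (hZ.congr hZN)
  rw [integral_congr_ae hZN, ← integral_map hN hm, integral_countable hint]
  refine tsum_congr fun j => ?_
  rw [smul_eq_mul, mul_comm, map_measureReal_apply_of_aemeasurable hN (measurableSet_singleton j)]
  congr 1
  refine measureReal_congr ?_
  filter_upwards [hnat] with ω ⟨l, hl⟩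
  refine propext ?_
  change Z ω = j ↔ ⌊Z ω⌋₊ = j
  rw [hl, Nat.floor_natCast, Nat.cast_inj]

variable {m : ℕ → ℕ} {P : (ν : ℕ) → PMF (Fin (m ν + 1))}
  {Ω : Type*} [MeasurableSpace Ω] {μ : Measure Ω} [IsProbabilityMeasure μ] {Z : Ω → ℝ}

/-- The limit is integer-valued: the integers are closed and carry all the mass before the limit. -/
theorem ae_exists_nat_eq
    (hXZ : TendstoInDistribution (fun (ν : ℕ) (x : Fin (m ν + 1)) => ((x : ℕ) : ℝ)) atTop Z
      (fun ν => (P ν).toMeasure) μ) :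
    ∀ᵐ ω ∂μ, ∃ l : ℕ, Z ω = l := by
  have hF : IsClosed (Set.range (Nat.cast : ℕ → ℝ)) := Nat.isClosedEmbedding_coe_real.isClosed_range
  have h := ProbabilityMeasure.limsup_measure_closed_le_of_tendsto hXZ.tendsto hF
  have h1 : ∀ ν, (Measure.map (fun x : Fin (m ν + 1) => ((x : ℕ) : ℝ)) (P ν).toMeasure)
      (Set.range (Nat.cast : ℕ → ℝ)) = 1 := by
    intro ν
    rw [Measure.map_apply measurable_from_top hF.measurableSet]
    have : (fun x : Fin (m ν + 1) => ((x : ℕ) : ℝ)) ⁻¹' (Set.range (Nat.cast : ℕ → ℝ))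
        = Set.univ := by
      ext x; simp
    rw [this, measure_univ]
  simp only [ProbabilityMeasure.coe_mk, h1, limsup_const] at h
  rw [Measure.map_apply_of_aemeasurable hXZ.aemeasurable_limit hF.measurableSet] at h
  have h2 : μ (Z ⁻¹' Set.range (Nat.cast : ℕ → ℝ)) = 1 := le_antisymm prob_le_one h
  have hnull : NullMeasurableSet (Z ⁻¹' Set.range (Nat.cast : ℕ → ℝ)) μ :=
    hXZ.aemeasurable_limit.nullMeasurable hF.measurableSet
  have h3 := (mem_ae_iff_prob_eq_one₀ hnull).2 h2
  filter_upwards [h3] with ω hω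
  obtain ⟨l, hl⟩ := hω
  exact ⟨l, hl.symm⟩

/-- A tent function centred at `j` picks out the mass at `j` of an integer-valued variable. -/
theorem tendsto_measureReal_eq
    (hXZ : TendstoInDistribution (fun (ν : ℕ) (x : Fin (m ν + 1)) => ((x : ℕ) : ℝ)) atTop Z
      (fun ν => (P ν).toMeasure) μ) (j : ℕ) :
    Tendsto (fun ν => (P ν).toMeasure.real {x | (x : ℕ) = j}) atTop
      (𝓝 (μ.real {ω | Z ω = (j : ℝ)})) := by
  have hcont : Continuous fun x : ℝ => max 0 (1 - |x - j|) := by fun_prop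
  let f : BoundedContinuousFunction ℝ ℝ := BoundedContinuousFunction.ofNormedAddCommGroup
    (fun x : ℝ => max 0 (1 - |x - j|)) hcont 1 fun x => by
      rw [Real.norm_eq_abs, abs_of_nonneg (le_max_left _ _)]
      exact max_le zero_le_one (by linarith [abs_nonneg (x - j)])
  have hf : ∀ x, f x = max 0 (1 - |x - j|) := fun x => rfl
  have hfn : ∀ l : ℕ, f l = if l = j then 1 else 0 := by
    intro l
    rw [hf]
    split_ifs with hl
    · simp [hl]
    · refine max_eq_left ?_
      have : (1 : ℝ) ≤ |(l : ℝ) - j| := by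
        have : (1 : ℤ) ≤ |(l : ℤ) - j| := Int.one_le_abs (by omega)
        exact_mod_cast this
      linarith
  have h := (ProbabilityMeasure.tendsto_iff_forall_integral_tendsto.1 hXZ.tendsto) f
  simp only [ProbabilityMeasure.coe_mk] at h
  rw [integral_map hXZ.aemeasurable_limit f.continuous.aestronglyMeasurable] at h
  have e1 : ∫ ω, f (Z ω) ∂μ = μ.real {ω | Z ω = (j : ℝ)} := by
    have hnull : NullMeasurableSet {ω | Z ω = (j : ℝ)} μ :=
      hXZ.aemeasurable_limit.nullMeasurable (measurableSet_singleton (j : ℝ))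
    have : ∫ ω in {ω | Z ω = (j : ℝ)}, (1 : ℝ) ∂μ = μ.real {ω | Z ω = (j : ℝ)} := by simp
    rw [← this, ← integral_indicator₀ hnull]
    refine integral_congr_ae ?_
    filter_upwards [ae_exists_nat_eq hXZ] with ω hω
    obtain ⟨l, hl⟩ := hω
    simp only [Set.indicator, Set.mem_ofPred_eq, hl, hfn, Nat.cast_inj]
  rw [e1] at h
  refine h.congr fun ν => ?_
  rw [integral_map measurable_from_top.aemeasurable f.continuous.aestronglyMeasurable,
    ← integral_indicator_one (MeasurableSet.of_discrete)]
  refine integral_congr_ae (Eventually.of_forall fun x => ?_)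
  simp only [Set.indicator, Set.mem_ofPred_eq, hfn, Pi.one_apply]

theorem hasSum_integral_fin (m : ℕ) (P : PMF (Fin (m + 1))) (g : ℕ → ℝ) :
    HasSum (fun j : ℕ => g j * P.toMeasure.real {x | (x : ℕ) = j}) (∫ x, g x ∂P.toMeasure) := by
  rw [integral_fintype .of_finite]
  have : ∑ x : Fin (m + 1), P.toMeasure.real {x} • g x
      = ∑ j ∈ Finset.range (m + 1), g j * P.toMeasure.real {x | (x : ℕ) = j} := by
    rw [Finset.sum_range]
    refine Finset.sum_congr rfl fun x _ => ?_
    rw [smul_eq_mul, mul_comm]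
    congr 2
    ext y
    simp [Fin.ext_iff]
  rw [this]
  refine hasSum_sum_of_ne_finset_zero fun j hj => ?_
  have : {x : Fin (m + 1) | (x : ℕ) = j} = ∅ := by
    ext x
    have hx := x.2
    simp only [Finset.mem_range, not_lt, Set.mem_ofPred_eq, Set.mem_empty_iff_false,
      iff_false] at hj ⊢
    omega
  rw [this]
  simp

theorem integrable_of_integrable_pow_three (hZm : AEMeasurable Z μ)
    (hZ3 : Integrable (fun ω => Z ω ^ 3) μ) : Integrable Z μ := by
  refine Integrable.mono' ((integrable_const 1).add hZ3.norm) hZm.aestronglyMeasurable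
    (Eventually.of_forall fun ω => ?_)
  simp only [Pi.add_apply, norm_pow]
  have := norm_nonneg (Z ω)
  nlinarith [sq_nonneg (‖Z ω‖ - 1), mul_nonneg this (sq_nonneg (‖Z ω‖ - 1))]

/-- Convergence of the means; the third moments provide the dominating series `C / j ^ 2`. -/
theorem tendsto_integral_nat
    (hXZ : TendstoInDistribution (fun (ν : ℕ) (x : Fin (m ν + 1)) => ((x : ℕ) : ℝ)) atTop Z
      (fun ν => (P ν).toMeasure) μ) {C : ℝ}
    (hX3 : ∀ᶠ ν in atTop, ∫ x, ((x : ℕ) : ℝ) ^ 3 ∂(P ν).toMeasure ≤ C) :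
    Tendsto (fun ν => ∫ x, ((x : ℕ) : ℝ) ∂(P ν).toMeasure) atTop
      (𝓝 (∑' j : ℕ, (j : ℝ) * μ.real {ω | Z ω = (j : ℝ)})) := by
  have hs : Summable fun j : ℕ => C * (1 / (j : ℝ) ^ 2) :=
    (Real.summable_one_div_nat_pow.2 one_lt_two).mul_left C
  refine (tendsto_tsum_of_dominated_convergence hs
    (fun j => (tendsto_measureReal_eq hXZ j).const_mul (j : ℝ)) ?_).congr
      fun ν => (hasSum_integral_fin (m ν) (P ν) (fun j => (j : ℝ))).tsum_eq
  filter_upwards [hX3] with ν hν j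
  rcases Nat.eq_zero_or_pos j with rfl | hj
  · simp
  have h1 := le_hasSum (hasSum_integral_fin (m ν) (P ν) (fun j => (j : ℝ) ^ 3)) j
    fun i _ => by positivity
  have hj' : (0 : ℝ) < j := by exact_mod_cast hj
  rw [Real.norm_eq_abs, abs_of_nonneg (by positivity), mul_one_div, le_div_iff₀ (by positivity)]
  calc _ = (j : ℝ) ^ 3 * (P ν).toMeasure.real {x | (x : ℕ) = j} := by ring
    _ ≤ C := h1.trans hν

theorem integral_pos_of_measure_two_le_pos (hZ : Integrable Z μ) (h0 : 0 ≤ᵐ[μ] Z)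
    (hZ2 : 0 < μ {ω | 2 ≤ Z ω}) : 0 < ∫ ω, Z ω ∂μ := by
  have h := mul_meas_ge_le_integral_of_nonneg h0 hZ 2
  have : 0 < μ.real {ω | 2 ≤ Z ω} := ENNReal.toReal_pos hZ2.ne' (measure_ne_top _ _)
  linarith

end Limit

/-! ### Exchangeability of the vertices -/

instance (m : ℕ) (P : PMF (Fin (m + 1))) (n : ℕ) : IsProbabilityMeasure (setsLaw n m P) := by
  unfold setsLaw; infer_instance

/-- A permutation carrying `(u₀, v₀)` to `(u, v)` and fixing every point other than these four. -/
theorem exists_perm_pair {α : Type*} [DecidableEq α] {u₀ v₀ u v : α} (h₀ : u₀ ≠ v₀) (h : u ≠ v) :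
    ∃ σ : Equiv.Perm α, σ u₀ = u ∧ σ v₀ = v ∧
      ∀ w, w ≠ u₀ → w ≠ v₀ → w ≠ u → w ≠ v → σ w = w := by
  have h1 : Equiv.swap u₀ u v₀ ≠ u := by
    intro h2
    have h3 : Equiv.swap u₀ u v₀ = Equiv.swap u₀ u u₀ := by rw [h2, Equiv.swap_apply_left]
    exact h₀ ((Equiv.swap u₀ u).injective h3).symm
  refine ⟨Equiv.swap (Equiv.swap u₀ u v₀) v * Equiv.swap u₀ u, ?_, ?_, ?_⟩
  · rw [Equiv.Perm.mul_apply, Equiv.swap_apply_left, Equiv.swap_apply_of_ne_of_ne h1.symm h]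
  · rw [Equiv.Perm.mul_apply, Equiv.swap_apply_left]
  · intro w hw1 hw2 hw3 hw4
    rw [Equiv.Perm.mul_apply, Equiv.swap_apply_of_ne_of_ne hw1 hw3]
    refine Equiv.swap_apply_of_ne_of_ne (fun h2 => hw2 ?_) hw4
    have h3 : Equiv.swap u₀ u w = Equiv.swap u₀ u v₀ := by
      rw [Equiv.swap_apply_of_ne_of_ne hw1 hw3, h2]
    exact (Equiv.swap u₀ u).injective h3

theorem sum_measureReal_eq_integral_card {Ω α : Type*} [MeasurableSpace Ω]
    [DiscreteMeasurableSpace Ω] {μ : Measure Ω} [IsFiniteMeasure μ] (s : Finset α)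
    (E : α → Set Ω) [∀ ω, DecidablePred fun a => ω ∈ E a] :
    ∑ a ∈ s, μ.real (E a) = ∫ ω, ((s.filter fun a => ω ∈ E a).card : ℝ) ∂μ := by
  have e : ∀ ω, ((s.filter fun a => ω ∈ E a).card : ℝ)
      = ∑ a ∈ s, Set.indicator (E a) (1 : Ω → ℝ) ω := by
    intro ω
    rw [Finset.card_filter]
    push_cast
    exact Finset.sum_congr rfl fun a _ => by simp [Set.indicator]
  simp only [e]
  rw [integral_finsetSum]
  · exact Finset.sum_congr rfl fun a _ => (integral_indicator_one .of_discrete).symm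
  · exact fun a _ => (integrable_const (1 : ℝ)).indicator .of_discrete

/-- Averaging over an exchangeable family of events. -/
theorem card_mul_measureReal_eq_integral_card {Ω α : Type*} [MeasurableSpace Ω]
    [DiscreteMeasurableSpace Ω] {μ : Measure Ω} [IsFiniteMeasure μ] (s : Finset α)
    (E : α → Set Ω) [∀ ω, DecidablePred fun a => ω ∈ E a] (a₀ : α)
    (hE : ∀ a ∈ s, ∃ f : Ω → Ω, MeasurePreserving f μ μ ∧ f ⁻¹' E a = E a₀) :
    (s.card : ℝ) * μ.real (E a₀) = ∫ ω, ((s.filter fun a => ω ∈ E a).card : ℝ) ∂μ := by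
  rw [← sum_measureReal_eq_integral_card, ← nsmul_eq_mul, ← Finset.sum_const]
  refine Finset.sum_congr rfl fun a ha => ?_
  obtain ⟨f, hf, he⟩ := hE a ha
  rw [← he, measureReal_def, hf.measure_preimage MeasurableSet.of_discrete.nullMeasurableSet,
    measureReal_def]

theorem setLaw_apply {m : ℕ} (P : PMF (Fin (m + 1))) (A : Finset (Fin m)) :
    setLaw m P A
      = P ⟨A.card, Nat.lt_succ_of_le (card_finset_fin_le A)⟩ / (m.choose A.card : ENNReal) := rfl

theorem measurePreserving_map_setLaw {m : ℕ} (P : PMF (Fin (m + 1))) (σ : Equiv.Perm (Fin m)) :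
    MeasurePreserving (fun A : Finset (Fin m) => A.map σ.toEmbedding)
      (setLaw m P).toMeasure (setLaw m P).toMeasure := by
  refine ⟨.of_discrete, Measure.ext_of_singleton fun A => ?_⟩
  rw [Measure.map_apply .of_discrete (measurableSet_singleton A)]
  have : (fun A : Finset (Fin m) => A.map σ.toEmbedding) ⁻¹' {A} = {A.map σ.symm.toEmbedding} := by
    ext B
    simp only [Set.mem_preimage, Set.mem_singleton_iff]
    constructor
    · rintro rfl
      ext x
      simp
    · rintro rfl
      ext x
      simp
  rw [this, PMF.toMeasure_apply_singleton _ _ (measurableSet_singleton _),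
    PMF.toMeasure_apply_singleton _ _ (measurableSet_singleton _), setLaw_apply, setLaw_apply]
  simp only [Finset.card_map]

/-- The size of a set with law `setLaw m P` has law `P`. -/
theorem measurePreserving_card {m : ℕ} (P : PMF (Fin (m + 1))) :
    MeasurePreserving
      (fun A : Finset (Fin m) =>
        (⟨A.card, Nat.lt_succ_of_le (card_finset_fin_le A)⟩ : Fin (m + 1)))
      (setLaw m P).toMeasure P.toMeasure := by
  classical
  refine ⟨.of_discrete, Measure.ext_of_singleton fun j => ?_⟩
  rw [Measure.map_apply .of_discrete (measurableSet_singleton j)]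
  have : (fun A : Finset (Fin m) =>
      (⟨A.card, Nat.lt_succ_of_le (card_finset_fin_le A)⟩ : Fin (m + 1))) ⁻¹' {j}
      = ((Finset.powersetCard j Finset.univ : Finset (Finset (Fin m))) : Set (Finset (Fin m))) := by
    ext A
    simp [Fin.ext_iff]
  rw [this, PMF.toMeasure_apply_finset,
    PMF.toMeasure_apply_singleton _ _ (measurableSet_singleton _)]
  have hc : (m.choose (j : ℕ) : ENNReal) ≠ 0 := by
    have := Nat.choose_pos (Nat.lt_succ_iff.mp j.2)
    exact_mod_cast this.ne'
  have h : ∀ A ∈ Finset.powersetCard (j : ℕ) (Finset.univ : Finset (Fin m)),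
      setLaw m P A = P j / (m.choose j : ENNReal) := by
    intro A hA
    have hA' := (Finset.mem_powersetCard.1 hA).2
    rw [setLaw_apply]
    congr 2
    · exact Fin.ext hA'
    · rw [hA']
  rw [Finset.sum_congr rfl h, Finset.sum_const, Finset.card_powersetCard, Finset.card_univ,
    Fintype.card_fin, nsmul_eq_mul]
  exact ENNReal.mul_div_cancel hc (ENNReal.natCast_ne_top _)

theorem integral_card_setLaw {m : ℕ} (P : PMF (Fin (m + 1))) (g : ℕ → ℝ) :
    ∫ A, g A.card ∂(setLaw m P).toMeasure = ∫ x, g x ∂P.toMeasure := by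
  conv_rhs => rw [← (measurePreserving_card P).map_eq]
  rw [integral_map Measurable.of_discrete.aemeasurable
    Measurable.of_discrete.aestronglyMeasurable]

/-- Double counting of pairs `w ∈ A`: the left side does not depend on `w`. -/
theorem mul_measureReal_mem_card {m : ℕ} (P : PMF (Fin (m + 1))) (w : Fin m) (B : Set ℕ) :
    (m : ℝ) * (setLaw m P).toMeasure.real {A | w ∈ A ∧ A.card ∈ B}
      = ∫ x, Set.indicator B (fun j => (j : ℝ)) (x : ℕ) ∂P.toMeasure := by
  classical
  have h := card_mul_measureReal_eq_integral_card (μ := (setLaw m P).toMeasure)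
    (Finset.univ : Finset (Fin m)) (fun u => {A | u ∈ A ∧ A.card ∈ B}) w (fun u _ =>
      ⟨_, measurePreserving_map_setLaw P (Equiv.swap w u), by
        ext A
        simp only [Set.mem_preimage, Set.mem_ofPred_eq, Finset.card_map, Finset.mem_map_equiv,
          Equiv.symm_swap, Equiv.swap_apply_right]⟩)
  rw [Finset.card_univ, Fintype.card_fin] at h
  rw [h, ← integral_card_setLaw P (Set.indicator B fun j => (j : ℝ))]
  refine integral_congr_ae (Eventually.of_forall fun A => ?_)
  by_cases hA : A.card ∈ B
  · simp [hA]
  · simp [hA]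

/-- Two given vertices lie in a random set `A` with probability `E |A| (|A| - 1) / (m (m - 1))`. -/
theorem mul_measureReal_mem_mem {m : ℕ} (P : PMF (Fin (m + 1))) {u v : Fin m} (huv : u ≠ v) :
    ((m : ℝ) * (m - 1)) * (setLaw m P).toMeasure.real {A | u ∈ A ∧ v ∈ A}
      = ∫ x, ((x : ℕ) : ℝ) * ((x : ℕ) - 1) ∂P.toMeasure := by
  classical
  have hcard : ∀ s : Finset (Fin m), (s.offDiag.card : ℝ) = s.card * (s.card - 1) := by
    intro s
    rw [Finset.offDiag_card, Nat.cast_sub (Nat.le_mul_self _)]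
    push_cast
    ring
  have h := card_mul_measureReal_eq_integral_card (μ := (setLaw m P).toMeasure)
    (Finset.univ : Finset (Fin m)).offDiag (fun x => {A | x.1 ∈ A ∧ x.2 ∈ A}) (u, v) (fun x hx => by
      obtain ⟨σ, h1, h2, -⟩ := exists_perm_pair huv (Finset.mem_offDiag.1 hx).2.2
      refine ⟨_, measurePreserving_map_setLaw P σ, ?_⟩
      ext A
      simp only [Set.mem_preimage, Set.mem_ofPred_eq, Finset.mem_map_equiv, ← h1, ← h2,
        Equiv.symm_apply_apply])
  rw [hcard, Finset.card_univ, Fintype.card_fin] at h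
  rw [h, ← integral_card_setLaw P fun j => (j : ℝ) * (j - 1)]
  refine integral_congr_ae (Eventually.of_forall fun A => ?_)
  simp only
  rw [← hcard]
  congr 2
  ext x
  simp only [Finset.mem_filter, Finset.mem_offDiag, Finset.mem_univ, true_and, Set.mem_ofPred_eq]
  tauto

/-- The action of a permutation of `W` on a family of subsets of `W`. -/
def permute {n m : ℕ} (σ : Equiv.Perm (Fin m)) (D : Fin n → Finset (Fin m)) :
    Fin n → Finset (Fin m) := fun i => (D i).map σ.toEmbedding

theorem measurePreserving_permute {n m : ℕ} (P : PMF (Fin (m + 1))) (σ : Equiv.Perm (Fin m)) :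
    MeasurePreserving (permute σ) (setsLaw n m P) (setsLaw n m P) :=
  measurePreserving_pi _ _ fun _ => measurePreserving_map_setLaw P σ

theorem adj_permute_iff {n m s : ℕ} (σ : Equiv.Perm (Fin m)) (D : Fin n → Finset (Fin m))
    (u v : Fin m) :
    (passiveGraph s (permute σ D)).Adj (σ u) (σ v) ↔ (passiveGraph s D).Adj u v := by
  simp [passiveGraph, permute]

theorem degree_permute {n m s : ℕ} (σ : Equiv.Perm (Fin m)) (D : Fin n → Finset (Fin m))
    (w : Fin m) : degree s (permute σ D) (σ w) = degree s D w := by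
  unfold degree
  rw [← Set.ncard_image_of_injective ((passiveGraph s D).neighborSet w) σ.injective]
  congr 1
  ext u
  obtain ⟨u, rfl⟩ := σ.surjective u
  refine Iff.trans ?_ σ.injective.mem_set_image.symm
  exact adj_permute_iff σ D w u

theorem adj_iff {n m : ℕ} {D : Fin n → Finset (Fin m)} {u v : Fin m} :
    (passiveGraph 1 D).Adj u v ↔ u ≠ v ∧ ∃ i, u ∈ D i ∧ v ∈ D i := by
  refine and_congr Iff.rfl ?_
  rw [Nat.one_le_iff_ne_zero, ← Nat.pos_iff_ne_zero, Finset.card_pos]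
  simp [Finset.Nonempty]

open Classical in
/-- The neighbourhood of `w` in the passive graph with `s = 1`, as a finset. -/
noncomputable def neighbors {n m : ℕ} (D : Fin n → Finset (Fin m)) (w : Fin m) : Finset (Fin m) :=
  Finset.univ.filter fun u => (passiveGraph 1 D).Adj w u

open Classical in
/-- The ordered pairs of adjacent neighbours of `w`. -/
noncomputable def adjacentPairs {n m : ℕ} (D : Fin n → Finset (Fin m)) (w : Fin m) :
    Finset (Fin m × Fin m) :=
  (neighbors D w).offDiag.filter fun x => (passiveGraph 1 D).Adj x.1 x.2

theorem mem_neighbors {n m : ℕ} {D : Fin n → Finset (Fin m)} {w u : Fin m} :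
    u ∈ neighbors D w ↔ (passiveGraph 1 D).Adj w u := by
  simp [neighbors]

theorem degree_eq_card_neighbors {n m : ℕ} (D : Fin n → Finset (Fin m)) (w : Fin m) :
    degree 1 D w = (neighbors D w).card := by
  rw [degree, ← Set.ncard_coe_finset]
  congr 1
  ext u
  simp [mem_neighbors]

/-- The average over all pairs `(w₂, w₃)` of a permutation-invariant relation on the event
`w₁ ∼ w₂, w₁ ∼ w₃, d(w₁) = k`. -/
theorem mul_measureReal_cherryEvent_inter {n m k : ℕ} (P : PMF (Fin (m + 1))) {w₁ w₂ w₃ : Fin m}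
    (h12 : w₁ ≠ w₂) (h13 : w₁ ≠ w₃) (h23 : w₂ ≠ w₃)
    (R : (Fin n → Finset (Fin m)) → Fin m → Fin m → Prop)
    (hR : ∀ σ D u v, R (permute σ D) (σ u) (σ v) ↔ R D u v)
    [∀ D, DecidablePred fun x : Fin m × Fin m => R D x.1 x.2] :
    (((m : ℝ) - 1) * (m - 2))
        * (setsLaw n m P).real (cherryEvent n m k w₁ w₂ w₃ ∩ {D | R D w₂ w₃})
      = ∫ D in {D | degree 1 D w₁ = k},
          (((neighbors D w₁).offDiag.filter fun x => R D x.1 x.2).card : ℝ)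
          ∂(setsLaw n m P) := by
  classical
  have hmpos : 1 ≤ m := by have := w₁.2; omega
  have h := card_mul_measureReal_eq_integral_card (μ := setsLaw n m P)
    (Finset.univ.erase w₁).offDiag
    (fun x => cherryEvent n m k w₁ x.1 x.2 ∩ {D | R D x.1 x.2}) (w₂, w₃) (fun x hx => by
      obtain ⟨hx1, hx2, hx3⟩ := Finset.mem_offDiag.1 hx
      obtain ⟨σ, h1, h2, h3⟩ := exists_perm_pair h23 hx3
      have h4 : σ w₁ = w₁ :=
        h3 w₁ h12 h13 (Finset.ne_of_mem_erase hx1).symm (Finset.ne_of_mem_erase hx2).symm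
      refine ⟨_, measurePreserving_permute P σ, ?_⟩
      ext D
      have e1 := adj_permute_iff (s := 1) σ D w₁ w₂
      have e2 := adj_permute_iff (s := 1) σ D w₁ w₃
      have e3 := degree_permute (s := 1) σ D w₁
      have e4 := hR σ D w₂ w₃
      rw [h4, h1] at e1
      rw [h4, h2] at e2
      rw [h4] at e3
      rw [h1, h2] at e4
      simp only [cherryEvent, Set.mem_preimage, Set.mem_inter_iff, Set.mem_ofPred_eq, e1, e2, e3,
        e4])
  rw [Finset.offDiag_card, Finset.card_erase_of_mem (Finset.mem_univ _), Finset.card_univ,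
    Fintype.card_fin, Nat.cast_sub (Nat.le_mul_self _), Nat.cast_mul, Nat.cast_sub hmpos] at h
  rw [← integral_indicator .of_discrete, show ((m : ℝ) - 1) * (m - 2)
    = ((m : ℝ) - (1 : ℕ)) * (m - (1 : ℕ)) - (m - (1 : ℕ)) by push_cast; ring, h]
  refine integral_congr_ae (Eventually.of_forall fun D => ?_)
  by_cases hD : degree 1 D w₁ = k
  · rw [Set.indicator_of_mem (by exact hD)]
    simp only
    congr 2
    ext x
    have hne : ∀ u, (passiveGraph 1 D).Adj w₁ u → u ≠ w₁ := fun u hu => hu.ne'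
    simp only [cherryEvent, Finset.mem_filter, Finset.mem_offDiag, Finset.mem_erase,
      Finset.mem_univ, Set.mem_inter_iff, Set.mem_ofPred_eq, mem_neighbors, hD]
    have h1 := hne x.1
    have h2 := hne x.2
    tauto
  · rw [Set.indicator_of_notMem (by exact hD)]
    simp only [cherryEvent, Set.mem_inter_iff, Set.mem_ofPred_eq, hD]
    simp

theorem mul_measureReal_cherryEvent {n m k : ℕ} (P : PMF (Fin (m + 1))) {w₁ w₂ w₃ : Fin m}
    (h12 : w₁ ≠ w₂) (h13 : w₁ ≠ w₃) (h23 : w₂ ≠ w₃) :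
    (((m : ℝ) - 1) * (m - 2)) * (setsLaw n m P).real (cherryEvent n m k w₁ w₂ w₃)
      = ((k : ℝ) * (k - 1)) * (setsLaw n m P).real {D | degree 1 D w₁ = k} := by
  classical
  have h := mul_measureReal_cherryEvent_inter (n := n) (k := k) P h12 h13 h23
    (fun _ _ _ => True) (by simp)
  simp only [Set.ofPred_true, Set.inter_univ, Finset.filter_true] at h
  rw [h, setIntegral_congr_fun (g := fun _ => (k : ℝ) * (k - 1)) .of_discrete, setIntegral_const,
    smul_eq_mul, mul_comm]
  intro D hD
  have hD' : degree 1 D w₁ = k := hD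
  simp only
  rw [Finset.offDiag_card, ← degree_eq_card_neighbors, hD', Nat.cast_sub (Nat.le_mul_self _)]
  push_cast
  ring

/-- The clustering coefficient as a ratio of the expected number of ordered adjacent pairs among
the neighbours to the expected number of ordered pairs of neighbours, on the event `d(w₁) = k`. -/
theorem clustering_eq {n m k : ℕ} (P : PMF (Fin (m + 1))) {w₁ w₂ w₃ : Fin m}
    (h12 : w₁ ≠ w₂) (h13 : w₁ ≠ w₃) (h23 : w₂ ≠ w₃) :
    clustering n m P k w₁ w₂ w₃
      = (∫ D in {D | degree 1 D w₁ = k}, ((adjacentPairs D w₁).card : ℝ) ∂(setsLaw n m P))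
        / (((k : ℝ) * (k - 1)) * (setsLaw n m P).real {D | degree 1 D w₁ = k}) := by
  classical
  have hm : (2 : ℝ) < m := by
    have h1 := w₁.2
    have h2 := w₂.2
    have h3 := w₃.2
    have : (2 : ℕ) < m := by
      have e1 : (w₁ : ℕ) ≠ w₂ := fun h => h12 (Fin.ext h)
      have e2 : (w₁ : ℕ) ≠ w₃ := fun h => h13 (Fin.ext h)
      have e3 : (w₂ : ℕ) ≠ w₃ := fun h => h23 (Fin.ext h)
      omega
    exact_mod_cast this
  have hM : ((m : ℝ) - 1) * (m - 2) ≠ 0 := by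
    have : 0 < ((m : ℝ) - 1) * (m - 2) := mul_pos (by linarith) (by linarith)
    exact this.ne'
  have e1 := mul_measureReal_cherryEvent_inter (n := n) (k := k) P h12 h13 h23
    (fun D u v => (passiveGraph 1 D).Adj u v) (fun σ D u v => adj_permute_iff σ D u v)
  have e2 := mul_measureReal_cherryEvent (n := n) (k := k) P h12 h13 h23
  rw [← e2, clustering, measureReal_def, cond_apply .of_discrete,
    ENNReal.toReal_mul, ENNReal.toReal_inv, ← measureReal_def, ← measureReal_def]
  have e3 : ∀ D : Fin n → Finset (Fin m), adjacentPairs D w₁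
      = (neighbors D w₁).offDiag.filter fun x => (passiveGraph 1 D).Adj x.1 x.2 := fun D => rfl
  simp only [e3]
  rw [← e1, mul_div_mul_left _ _ hM, inv_mul_eq_div]

/-! ### Overlaps -/

/-- The vertices that `A` joins to `w`: the other elements of `A` if `w ∈ A`, and none if not. -/
def block {m : ℕ} (w : Fin m) (A : Finset (Fin m)) : Finset (Fin m) :=
  if w ∈ A then A.erase w else ∅

theorem mem_block {m : ℕ} {w u : Fin m} {A : Finset (Fin m)} :
    u ∈ block w A ↔ w ∈ A ∧ u ∈ A ∧ u ≠ w := by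
  unfold block
  split_ifs with h
  · simp [h, and_comm]
  · simp [h]

/-- Two different sets share an edge at `w`. -/
def doubleEdge {n m : ℕ} (w : Fin m) : Set (Fin n → Finset (Fin m)) :=
  {D | ∃ i j u, i ≠ j ∧ w ≠ u ∧ (w ∈ D i ∧ u ∈ D i) ∧ (w ∈ D j ∧ u ∈ D j)}

/-- The three edges of a triangle at `w` come from three different sets. -/
def mixedTriangle {n m : ℕ} (w : Fin m) : Set (Fin n → Finset (Fin m)) :=
  {D | ∃ i j l u v, (i ≠ j ∧ i ≠ l ∧ j ≠ l) ∧ (w ≠ u ∧ w ≠ v ∧ u ≠ v) ∧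
    (w ∈ D i ∧ u ∈ D i) ∧ (w ∈ D j ∧ v ∈ D j) ∧ (u ∈ D l ∧ v ∈ D l)}

theorem neighbors_eq_biUnion {n m : ℕ} (D : Fin n → Finset (Fin m)) (w : Fin m) :
    neighbors D w = Finset.univ.biUnion fun i => block w (D i) := by
  ext u
  rw [mem_neighbors, adj_iff]
  simp only [Finset.mem_biUnion, Finset.mem_univ, true_and, mem_block]
  constructor
  · rintro ⟨h, i, h1, h2⟩
    exact ⟨i, h1, h2, h.symm⟩
  · rintro ⟨i, h1, h2, h⟩
    exact ⟨h.symm, i, h1, h2⟩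

theorem disjoint_block {n m : ℕ} {D : Fin n → Finset (Fin m)} {w : Fin m}
    (hD : D ∉ doubleEdge w) {i j : Fin n} (hij : i ≠ j) :
    Disjoint (block w (D i)) (block w (D j)) := by
  refine Finset.disjoint_left.2 fun u h1 h2 => hD ?_
  rw [mem_block] at h1 h2
  exact ⟨i, j, u, hij, h1.2.2.symm, ⟨h1.1, h1.2.1⟩, ⟨h2.1, h2.2.1⟩⟩

theorem degree_eq_sum_card_block {n m : ℕ} {D : Fin n → Finset (Fin m)} {w : Fin m}
    (hD : D ∉ doubleEdge w) : degree 1 D w = ∑ i, (block w (D i)).card := by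
  rw [degree_eq_card_neighbors, neighbors_eq_biUnion]
  exact Finset.card_biUnion fun i _ j _ hij => disjoint_block hD hij

theorem card_adjacentPairs_eq_sum {n m : ℕ} {D : Fin n → Finset (Fin m)} {w : Fin m}
    (hD : D ∉ doubleEdge w) (hD' : D ∉ mixedTriangle w) :
    (adjacentPairs D w).card = ∑ i, (block w (D i)).card.descFactorial 2 := by
  classical
  have e : adjacentPairs D w = Finset.univ.biUnion fun i => (block w (D i)).offDiag := by
    ext x
    simp only [adjacentPairs, neighbors_eq_biUnion, Finset.mem_filter, Finset.mem_offDiag,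
      Finset.mem_biUnion, Finset.mem_univ, true_and, adj_iff]
    constructor
    · rintro ⟨⟨⟨i, hi⟩, ⟨j, hj⟩, hne⟩, -, l, hl1, hl2⟩
      rw [mem_block] at hi hj
      by_cases hij : i = j
      · subst hij
        exact ⟨i, mem_block.2 hi, mem_block.2 hj, hne⟩
      by_cases hil : i = l
      · subst hil
        exact ⟨i, mem_block.2 hi, mem_block.2 ⟨hi.1, hl2, hj.2.2⟩, hne⟩
      by_cases hjl : j = l
      · subst hjl
        exact ⟨j, mem_block.2 ⟨hj.1, hl1, hi.2.2⟩, mem_block.2 hj, hne⟩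
      exact absurd ⟨i, j, l, x.1, x.2, ⟨hij, hil, hjl⟩, ⟨hi.2.2.symm, hj.2.2.symm, hne⟩,
        ⟨hi.1, hi.2.1⟩, ⟨hj.1, hj.2.1⟩, ⟨hl1, hl2⟩⟩ hD'
    · rintro ⟨i, h1, h2, hne⟩
      exact ⟨⟨⟨i, h1⟩, ⟨i, h2⟩, hne⟩, hne, i, (mem_block.1 h1).2.1, (mem_block.1 h2).2.1⟩
  rw [e, Finset.card_biUnion]
  · refine Finset.sum_congr rfl fun i _ => ?_
    rw [Finset.offDiag_card, Nat.descFactorial_succ, Nat.descFactorial_one, Nat.sub_mul, one_mul]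
  · intro i _ j _ hij
    refine Finset.disjoint_left.2 fun x h1 h2 => ?_
    exact Finset.disjoint_left.1 (disjoint_block hD hij) (Finset.mem_offDiag.1 h1).1
      (Finset.mem_offDiag.1 h2).1

/-- Independence of finitely many of the sets. -/
theorem measureReal_forall_mem_eq_prod {n m r : ℕ} (P : PMF (Fin (m + 1))) {a : Fin r → Fin n}
    (ha : Function.Injective a) (B : Fin r → Set (Finset (Fin m))) :
    (setsLaw n m P).real {D | ∀ t, D (a t) ∈ B t}
      = ∏ t, (setLaw m P).toMeasure.real (B t) := by
  have hind : iIndepFun (fun (i : Fin n) (D : Fin n → Finset (Fin m)) => D i) (setsLaw n m P) :=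
    iIndepFun_pi (X := fun _ A => A) fun _ => aemeasurable_id
  have h := (hind.precomp ha).measure_inter_preimage_eq_mul Finset.univ (sets := B)
    fun _ _ => .of_discrete
  have e : {D : Fin n → Finset (Fin m) | ∀ t, D (a t) ∈ B t}
      = ⋂ i ∈ (Finset.univ : Finset (Fin r)), (fun D => D (a i)) ⁻¹' B i := by
    ext D; simp
  rw [measureReal_def, e]
  refine (congrArg ENNReal.toReal h).trans ?_
  rw [ENNReal.toReal_prod]
  refine Finset.prod_congr rfl fun t _ => ?_
  rw [measureReal_def, ← (measurePreserving_eval (fun _ : Fin n => (setLaw m P).toMeasure)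
    (a t)).measure_preimage MeasurableSet.of_discrete.nullMeasurableSet]
  rfl

theorem measureReal_biUnion_le_card_mul {Ω α : Type*} [MeasurableSpace Ω] {μ : Measure Ω}
    [IsFiniteMeasure μ] {s : Finset α} {E : α → Set Ω} {c : ℝ} (hE : ∀ a ∈ s, μ.real (E a) ≤ c) :
    μ.real (⋃ a ∈ s, E a) ≤ s.card * c := by
  refine (measureReal_biUnion_finset_le s E).trans ((Finset.sum_le_sum hE).trans ?_)
  rw [Finset.sum_const, nsmul_eq_mul]

theorem measureReal_doubleEdge_le {n m : ℕ} (P : PMF (Fin (m + 1))) (w : Fin m) {ρ : ℝ}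
    (hρ : ∀ u v, u ≠ v → (setLaw m P).toMeasure.real {A | u ∈ A ∧ v ∈ A} ≤ ρ) (hρ0 : 0 ≤ ρ) :
    (setsLaw n m P).real (doubleEdge w) ≤ (n : ℝ) ^ 2 * m * ρ ^ 2 := by
  classical
  let s : Finset (Fin n × Fin n × Fin m) :=
    Finset.univ.filter fun x => x.1 ≠ x.2.1 ∧ w ≠ x.2.2
  have hs : (s.card : ℝ) ≤ (n : ℝ) ^ 2 * m := by
    have : s.card ≤ _ := Finset.card_filter_le _ _
    rw [Finset.card_univ, Fintype.card_prod, Fintype.card_prod, Fintype.card_fin,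
      Fintype.card_fin] at this
    calc (s.card : ℝ) ≤ ((n * (n * m) : ℕ) : ℝ) := by exact_mod_cast this
      _ = _ := by push_cast; ring
  have hsub : doubleEdge (n := n) w ⊆ ⋃ x ∈ s, {D | ∀ t, D (![x.1, x.2.1] t) ∈
      (![{A | w ∈ A ∧ x.2.2 ∈ A}, {A | w ∈ A ∧ x.2.2 ∈ A}] : Fin 2 → Set (Finset (Fin m))) t} := by
    rintro D ⟨i, j, u, hij, hu, h1, h2⟩
    refine Set.mem_biUnion (x := (i, j, u)) ?_ ?_
    · simp [s, hij, hu]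
    · simp [Fin.forall_fin_two, h1, h2]
  refine (measureReal_mono hsub (measure_ne_top _ _)).trans
    ((measureReal_biUnion_le_card_mul (c := ρ ^ 2) ?_).trans ?_)
  · intro x hx
    obtain ⟨hx1, hx2⟩ := (Finset.mem_filter.1 hx).2
    rw [measureReal_forall_mem_eq_prod P (by
      intro a b hab
      fin_cases a <;> fin_cases b <;> simp_all), Fin.prod_univ_two]
    simp only [Matrix.cons_val_zero, Matrix.cons_val_one]
    rw [pow_two]
    exact mul_le_mul (hρ _ _ hx2) (hρ _ _ hx2) measureReal_nonneg hρ0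
  · exact mul_le_mul_of_nonneg_right hs (by positivity)

theorem measureReal_mixedTriangle_le {n m : ℕ} (P : PMF (Fin (m + 1))) (w : Fin m) {ρ : ℝ}
    (hρ : ∀ u v, u ≠ v → (setLaw m P).toMeasure.real {A | u ∈ A ∧ v ∈ A} ≤ ρ) (hρ0 : 0 ≤ ρ) :
    (setsLaw n m P).real (mixedTriangle w) ≤ (n : ℝ) ^ 3 * m ^ 2 * ρ ^ 3 := by
  classical
  let s : Finset (Fin n × Fin n × Fin n × Fin m × Fin m) :=
    Finset.univ.filter fun x => (x.1 ≠ x.2.1 ∧ x.1 ≠ x.2.2.1 ∧ x.2.1 ≠ x.2.2.1) ∧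
      (w ≠ x.2.2.2.1 ∧ w ≠ x.2.2.2.2 ∧ x.2.2.2.1 ≠ x.2.2.2.2)
  have hs : (s.card : ℝ) ≤ (n : ℝ) ^ 3 * m ^ 2 := by
    have : s.card ≤ _ := Finset.card_filter_le _ _
    simp only [Finset.card_univ, Fintype.card_prod, Fintype.card_fin] at this
    calc (s.card : ℝ) ≤ ((n * (n * (n * (m * m))) : ℕ) : ℝ) := by exact_mod_cast this
      _ = _ := by push_cast; ring
  have hsub : mixedTriangle (n := n) w ⊆ ⋃ x ∈ s, {D | ∀ t, D (![x.1, x.2.1, x.2.2.1] t) ∈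
      (![{A | w ∈ A ∧ x.2.2.2.1 ∈ A}, {A | w ∈ A ∧ x.2.2.2.2 ∈ A},
        {A | x.2.2.2.1 ∈ A ∧ x.2.2.2.2 ∈ A}] : Fin 3 → Set (Finset (Fin m))) t} := by
    rintro D ⟨i, j, l, u, v, h1, h2, h3, h4, h5⟩
    refine Set.mem_biUnion (x := (i, j, l, u, v)) ?_ ?_
    · exact Finset.mem_filter.2 ⟨Finset.mem_univ _, h1, h2⟩
    · intro t
      fin_cases t
      · exact h3
      · exact h4
      · exact h5
  refine (measureReal_mono hsub (measure_ne_top _ _)).trans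
    ((measureReal_biUnion_le_card_mul (c := ρ ^ 3) ?_).trans ?_)
  · intro x hx
    obtain ⟨⟨hx1, hx2, hx3⟩, hx4, hx5, hx6⟩ := (Finset.mem_filter.1 hx).2
    rw [measureReal_forall_mem_eq_prod P (by
      intro a b hab
      fin_cases a <;> fin_cases b <;> simp_all), Fin.prod_univ_three]
    have h1 : (setLaw m P).toMeasure.real {A | w ∈ A ∧ x.2.2.2.1 ∈ A}
        * (setLaw m P).toMeasure.real {A | w ∈ A ∧ x.2.2.2.2 ∈ A} ≤ ρ * ρ :=
      mul_le_mul (hρ _ _ hx4) (hρ _ _ hx5) measureReal_nonneg hρ0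
    have h2 := mul_le_mul h1 (hρ _ _ hx6) measureReal_nonneg (mul_nonneg hρ0 hρ0)
    calc _ ≤ ρ * ρ * ρ := h2
      _ = ρ ^ 3 := by ring
  · exact mul_le_mul_of_nonneg_right hs (by positivity)

/-! ### Comparison with a sum of independent block sizes -/

/-- The law of the size of `block w A` for a random set `A` with law `setLaw m P`. Empty blocks
come both from `w ∉ A` and from `A = {w}`; the mass `(j + 1) P(j + 1) / m` at `j ≥ 1` is the
probability that `A` has size `j + 1` and contains `w`. -/
noncomputable def blockLaw (m : ℕ) (P : PMF (Fin (m + 1))) : ℕ → ℝ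
  | 0 => 1 - (∫ x, ((x : ℕ) : ℝ) ∂P.toMeasure - P.toMeasure.real {x | (x : ℕ) = 1}) / m
  | j + 1 => ((j : ℝ) + 2) * P.toMeasure.real {x | (x : ℕ) = j + 2} / m

theorem integral_indicator_singleton {m : ℕ} (P : PMF (Fin (m + 1))) (l : ℕ) :
    ∫ x, Set.indicator {l} (fun j => (j : ℝ)) (x : ℕ) ∂P.toMeasure
      = l * P.toMeasure.real {x | (x : ℕ) = l} := by
  have : ∀ x : Fin (m + 1), Set.indicator {l} (fun j => (j : ℝ)) (x : ℕ)
      = Set.indicator {x : Fin (m + 1) | (x : ℕ) = l} (fun _ => (l : ℝ)) x := by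
    intro x
    by_cases hx : (x : ℕ) = l <;> simp [Set.indicator, hx]
  simp only [this]
  rw [integral_indicator .of_discrete, setIntegral_const, smul_eq_mul, mul_comm]

theorem measureReal_card_block_eq {m : ℕ} (P : PMF (Fin (m + 1))) (w : Fin m) (j : ℕ) :
    (setLaw m P).toMeasure.real {A | (block w A).card = j} = blockLaw m P j := by
  have hm : (m : ℝ) ≠ 0 := by
    have := w.2
    have : m ≠ 0 := by omega
    exact_mod_cast this
  have hcard : ∀ A : Finset (Fin m), (block w A).card = if w ∈ A then A.card - 1 else 0 := by
    intro A
    unfold block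
    split_ifs with h
    · exact Finset.card_erase_of_mem h
    · rfl
  cases j with
  | succ j =>
    have e : {A : Finset (Fin m) | (block w A).card = j + 1}
        = {A | w ∈ A ∧ A.card ∈ ({j + 2} : Set ℕ)} := by
      ext A
      simp only [Set.mem_ofPred_eq, hcard, Set.mem_singleton_iff]
      split_ifs with h
      · simp only [h, true_and]; omega
      · simp [h]
    have h := mul_measureReal_mem_card P w {j + 2}
    rw [integral_indicator_singleton] at h
    rw [e, blockLaw, eq_div_iff hm, mul_comm, h]
    push_cast
    ring
  | zero =>
    have e : {A : Finset (Fin m) | (block w A).card = 0}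
        = {A | w ∈ A ∧ A.card ∈ ({1}ᶜ : Set ℕ)}ᶜ := by
      ext A
      simp only [Set.mem_ofPred_eq, hcard, Set.mem_compl_iff, Set.mem_singleton_iff, not_and,
        not_not]
      split_ifs with h
      · have : A.card ≠ 0 := (Finset.card_pos.2 ⟨w, h⟩).ne'
        simp only [h, true_imp_iff]; omega
      · simp [h]
    have h := mul_measureReal_mem_card P w {1}ᶜ
    have h2 : ∫ x, Set.indicator ({1}ᶜ : Set ℕ) (fun j => (j : ℝ)) (x : ℕ) ∂P.toMeasure
        = ∫ x, ((x : ℕ) : ℝ) ∂P.toMeasure - P.toMeasure.real {x | (x : ℕ) = 1} := by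
      have h3 := integral_indicator_singleton P 1
      rw [Nat.cast_one, one_mul] at h3
      rw [← h3, ← integral_sub .of_finite .of_finite]
      refine integral_congr_ae (Eventually.of_forall fun x => ?_)
      by_cases hx : (x : ℕ) = 1 <;> simp [Set.indicator, hx]
    rw [e, probReal_compl_eq_one_sub .of_discrete, blockLaw, ← h2, ← h, mul_div_cancel_left₀ _ hm]

theorem abs_integral_sub_integral_le {Ω : Type*} [Finite Ω] [MeasurableSpace Ω]
    [DiscreteMeasurableSpace Ω] {μ : Measure Ω} [IsFiniteMeasure μ] {f g : Ω → ℝ} {B : Set Ω}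
    {C : ℝ} (hfg : ∀ ω, ω ∉ B → f ω = g ω) (hf : ∀ ω, 0 ≤ f ω ∧ f ω ≤ C)
    (hg : ∀ ω, 0 ≤ g ω ∧ g ω ≤ C) :
    |∫ ω, f ω ∂μ - ∫ ω, g ω ∂μ| ≤ C * μ.real B := by
  rw [← integral_sub .of_finite .of_finite]
  refine (abs_integral_le_integral_abs).trans ?_
  have : C * μ.real B = ∫ ω, Set.indicator B (fun _ => C) ω ∂μ := by
    rw [integral_indicator .of_discrete, setIntegral_const, smul_eq_mul, mul_comm]
  rw [this]
  refine integral_mono .of_finite .of_finite fun ω => ?_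
  by_cases hω : ω ∈ B
  · rw [Set.indicator_of_mem hω, abs_le]
    have h1 := hf ω
    have h2 := hg ω
    constructor <;> linarith
  · rw [Set.indicator_of_notMem hω, hfg ω hω, sub_self, abs_zero]

theorem iIndepFun_card_block {n m : ℕ} (P : PMF (Fin (m + 1))) (w : Fin m) :
    iIndepFun (fun (i : Fin n) (D : Fin n → Finset (Fin m)) => (block w (D i)).card)
      (setsLaw n m P) :=
  iIndepFun_pi (X := fun _ A => (block w A).card) fun _ => Measurable.of_discrete.aemeasurable

theorem measureReal_card_block_apply_eq {n m : ℕ} (P : PMF (Fin (m + 1))) (w : Fin m) (i : Fin n)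
    (j : ℕ) : (setsLaw n m P).real {D | (block w (D i)).card = j} = blockLaw m P j := by
  rw [← measureReal_card_block_eq P w j, measureReal_def, measureReal_def,
    ← (measurePreserving_eval (fun _ : Fin n => (setLaw m P).toMeasure) i).measure_preimage
      MeasurableSet.of_discrete.nullMeasurableSet]
  rfl

/-- The degree has the law of a sum of `n` independent block sizes, up to the probability of a
double edge. -/
theorem abs_measureReal_degree_sub_le {n m : ℕ} (P : PMF (Fin (m + 1))) (w : Fin m) (k : ℕ) :
    |(setsLaw n m P).real {D | degree 1 D w = k}
        - PowerSeries.coeff k (PowerSeries.mk (blockLaw m P) ^ n)|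
      ≤ (setsLaw n m P).real (doubleEdge w) := by
  have h := measureReal_sum_eq_coeff (fun _ => .of_discrete) (iIndepFun_card_block (n := n) P w)
    (measureReal_card_block_apply_eq P w) Finset.univ k
  rw [Finset.card_univ, Fintype.card_fin] at h
  rw [← h, ← integral_indicator_one .of_discrete, ← integral_indicator_one .of_discrete,
    ← one_mul ((setsLaw n m P).real (doubleEdge w))]
  have h01 : ∀ (s : Set (Fin n → Finset (Fin m))) D,
      0 ≤ Set.indicator s (1 : (Fin n → Finset (Fin m)) → ℝ) D ∧
        Set.indicator s (1 : (Fin n → Finset (Fin m)) → ℝ) D ≤ 1 := fun s D => by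
    by_cases hD : D ∈ s <;> simp [hD]
  refine abs_integral_sub_integral_le (fun D hD => ?_) (h01 _) (h01 _)
  have e := degree_eq_sum_card_block hD
  by_cases hk : degree 1 D w = k
  · rw [Set.indicator_of_mem (by exact hk), Set.indicator_of_mem (by exact e.symm.trans hk)]
  · rw [Set.indicator_of_notMem (by exact hk),
      Set.indicator_of_notMem (by exact fun h' => hk (e.trans h'))]

/-- Off the exceptional events the adjacent pairs of neighbours are the pairs inside the blocks; on
the event that the degree, or the sum of the block sizes, is `k`, either number is at most
`k ^ 2`. -/
theorem abs_setIntegral_card_adjacentPairs_sub_le {n m : ℕ} (P : PMF (Fin (m + 1))) (w : Fin m)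
    (k : ℕ) :
    |∫ D in {D | degree 1 D w = k}, ((adjacentPairs D w).card : ℝ) ∂(setsLaw n m P)
        - n * ∑ x ∈ Finset.HasAntidiagonal.antidiagonal k, (x.1.descFactorial 2 : ℝ)
          * blockLaw m P x.1
          * PowerSeries.coeff x.2 (PowerSeries.mk (blockLaw m P) ^ (n - 1))|
      ≤ (k : ℝ) ^ 2 * (setsLaw n m P).real (doubleEdge w ∪ mixedTriangle w) := by
  classical
  have h := setIntegral_sum_apply_eq (fun _ => .of_discrete) (iIndepFun_card_block (n := n) P w)
    (measureReal_card_block_apply_eq P w) (fun j => (j.descFactorial 2 : ℝ)) Finset.univ k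
  rw [Finset.card_univ, Fintype.card_fin] at h
  rw [← h, ← integral_indicator .of_discrete, ← integral_indicator .of_discrete]
  refine abs_integral_sub_integral_le (fun D hD => ?_) (fun D => ?_) (fun D => ?_)
  · simp only [Set.mem_union, not_or] at hD
    simp only [Set.indicator, Set.mem_ofPred_eq, degree_eq_sum_card_block hD.1,
      card_adjacentPairs_eq_sum hD.1 hD.2, Nat.cast_sum]
  · by_cases hD : degree 1 D w = k
    · rw [Set.indicator_of_mem (by exact hD)]
      refine ⟨by positivity, ?_⟩
      have h1 : (adjacentPairs D w).card ≤ (neighbors D w).offDiag.card :=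
        Finset.card_filter_le _ _
      rw [Finset.offDiag_card, ← degree_eq_card_neighbors, hD] at h1
      have h2 : (adjacentPairs D w).card ≤ k ^ 2 := by
        rw [pow_two]; omega
      exact_mod_cast h2
    · rw [Set.indicator_of_notMem (by exact hD)]
      exact ⟨le_rfl, by positivity⟩
  · by_cases hD : ∑ i, (block w (D i)).card = k
    · rw [Set.indicator_of_mem (by exact hD)]
      refine ⟨by positivity, ?_⟩
      have h2 : ∑ i, (block w (D i)).card.descFactorial 2 ≤ k ^ 2 := by
        calc ∑ i, (block w (D i)).card.descFactorial 2
            ≤ ∑ i, (block w (D i)).card * k := Finset.sum_le_sum fun i hi => by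
              rw [Nat.descFactorial_succ, Nat.descFactorial_one, mul_comm]
              refine Nat.mul_le_mul_left _ ((Nat.sub_le _ _).trans ?_)
              rw [← hD]
              exact Finset.single_le_sum (f := fun i => (block w (D i)).card)
                (fun _ _ => Nat.zero_le _) hi
          _ = k ^ 2 := by rw [← Finset.sum_mul, hD, pow_two]
      exact_mod_cast h2
    · rw [Set.indicator_of_notMem (by exact hD)]
      exact ⟨le_rfl, by positivity⟩

theorem measureReal_mem_mem_le {m : ℕ} (P : PMF (Fin (m + 1))) (hm : 2 ≤ m) {K : ℝ}
    (hK : ∫ x, ((x : ℕ) : ℝ) ^ 3 ∂P.toMeasure ≤ K) (u v : Fin m) (huv : u ≠ v) :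
    (setLaw m P).toMeasure.real {A | u ∈ A ∧ v ∈ A} ≤ K / (m * (m - 1)) := by
  have hm' : (2 : ℝ) ≤ m := by exact_mod_cast hm
  have hpos : 0 < (m : ℝ) * (m - 1) := mul_pos (by linarith) (by linarith)
  rw [le_div_iff₀ hpos, mul_comm, mul_measureReal_mem_mem P huv]
  refine (integral_mono .of_finite .of_finite fun x => ?_).trans hK
  rcases Nat.eq_zero_or_pos (x : ℕ) with hx | hx
  · simp [hx]
  · have h1 : (1 : ℝ) ≤ ((x : ℕ) : ℝ) := by exact_mod_cast hx
    simp only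
    nlinarith [mul_nonneg (sub_nonneg.2 h1) (sq_nonneg ((x : ℕ) : ℝ))]

/-- The union bounds for double edges and mixed triangles are of order `1 / m` when `n` is
proportional to `m`. -/
theorem tendsto_overlap_bound {β K : ℝ} (hβ : 0 < β) {m n : ℕ → ℕ} (hm : Tendsto m atTop atTop)
    (hmn : Tendsto (fun ν => (m ν : ℝ) / (n ν : ℝ)) atTop (𝓝 β)) :
    Tendsto (fun ν => (n ν : ℝ) ^ 2 * m ν * (K / (m ν * (m ν - 1))) ^ 2
      + (n ν : ℝ) ^ 3 * (m ν : ℝ) ^ 2 * (K / (m ν * (m ν - 1))) ^ 3) atTop (𝓝 0) := by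
  have hm' : Tendsto (fun ν => (m ν : ℝ)) atTop atTop := tendsto_natCast_atTop_atTop.comp hm
  have hinv : Tendsto (fun ν => (m ν : ℝ)⁻¹) atTop (𝓝 0) := tendsto_inv_atTop_zero.comp hm'
  have hq : Tendsto (fun ν => K * ((m ν : ℝ) / n ν)⁻¹ * (1 - (m ν : ℝ)⁻¹)⁻¹) atTop
      (𝓝 (K * β⁻¹ * (1 - 0)⁻¹)) :=
    ((hmn.inv₀ hβ.ne').const_mul K).mul ((hinv.const_sub 1).inv₀ (by norm_num))
  have h := ((hq.pow 2).add (hq.pow 3)).mul hinv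
  rw [mul_zero] at h
  refine h.congr' ?_
  filter_upwards [hm.eventually_ge_atTop 2] with ν hν
  have h1 : (2 : ℝ) ≤ m ν := by exact_mod_cast hν
  have h2 : (m ν : ℝ) ≠ 0 := by linarith
  have h3 : (m ν : ℝ) - 1 ≠ 0 := by linarith
  have h4 : 1 - (m ν : ℝ)⁻¹ = (m ν - 1) / m ν := by field_simp
  rw [h4, inv_div, inv_div]
  field_simp

end PassiveGraph

open PassiveGraph in
theorem theorem7
    -- sizes of the random graphs and the size distributions of the random sets
    (β : ℝ) (hβ : 0 < β) (m n : ℕ → ℕ)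
    (hm : Tendsto m atTop atTop) (hn : Tendsto n atTop atTop)
    (hmn : Tendsto (fun ν => (m ν : ℝ) / (n ν : ℝ)) atTop (𝓝 β))
    (P : (ν : ℕ) → PMF (Fin (m ν + 1)))
    -- the limit `Z` of the set sizes
    {Ω : Type*} [MeasurableSpace Ω] (μ : Measure Ω) [IsProbabilityMeasure μ] (Z : Ω → ℝ)
    (hXZ : TendstoInDistribution (fun (ν : ℕ) (x : Fin (m ν + 1)) => ((x : ℕ) : ℝ)) atTop Z
      (fun ν => (P ν).toMeasure) μ)
    (hZ3 : Integrable (fun ω => Z ω ^ 3) μ)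
    (hZ2 : 0 < μ {ω | 2 ≤ Z ω})
    (hX3 : Tendsto (fun ν => ∫ x, ((x : ℕ) : ℝ) ^ 3 ∂(P ν).toMeasure) atTop
      (𝓝 (∫ ω, Z ω ^ 3 ∂μ)))
    -- the variables `Λ` and `Z̃₁, Z̃₂, …` (indexed from `0`)
    {Ω' : Type*} [MeasurableSpace Ω'] (μ' : Measure Ω') [IsProbabilityMeasure μ']
    (Λ : Ω' → ℕ) (hΛm : Measurable Λ) (Zt : ℕ → Ω' → ℕ) (hZtm : ∀ i, Measurable (Zt i))
    (hΛ : HasLaw Λ (poissonMeasure (Real.toNNReal (β⁻¹ * ∫ ω, Z ω ∂μ))) μ')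
    (hZt : ∀ i j, μ'.real {ω | Zt i ω = j} =
      PassiveGraph.sizeBiased (fun l => μ.real {ω | Z ω = (l : ℝ)}) j)
    (hZtindep : iIndepFun Zt μ')
    (hΛZt : IndepFun Λ (fun ω i => Zt i ω) μ')
    -- the variables `d_*` and `d_{2*}`
    (dstar d2star : Ω' → ℕ)
    (hdstar : ∀ ω, dstar ω = ∑ j ∈ Finset.range (Λ ω), Zt j ω)
    (hd2star : ∀ ω, d2star ω = ∑ j ∈ Finset.range (Λ ω), (Zt j ω).descFactorial 2)
    (k : ℕ) (hk : 2 ≤ k) (hkpos : 0 < μ' {ω | dstar ω = k}) :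
    -- the conditional probabilities are well defined for all large `ν`
    (∀ᶠ ν in atTop, ∀ w₁ w₂ w₃ : Fin (m ν), w₁ ≠ w₂ → w₁ ≠ w₃ → w₂ ≠ w₃ →
      0 < PassiveGraph.setsLaw (n ν) (m ν) (P ν)
        (PassiveGraph.cherryEvent (n ν) (m ν) k w₁ w₂ w₃)) ∧
    -- and converge to the stated limit
    (∀ ε : ℝ, 0 < ε → ∀ᶠ ν in atTop,
      ∀ w₁ w₂ w₃ : Fin (m ν), w₁ ≠ w₂ → w₁ ≠ w₃ → w₂ ≠ w₃ →
        |PassiveGraph.clustering (n ν) (m ν) (P ν) k w₁ w₂ w₃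
          - (1 / ((k : ℝ) * ((k : ℝ) - 1))) *
            ∫ ω, (d2star ω : ℝ) ∂(cond μ' {ω | dstar ω = k})| < ε) := by
  have hZm := hXZ.aemeasurable_limit
  have hnat := ae_exists_nat_eq hXZ
  have hZ := integrable_of_integrable_pow_three hZm hZ3
  have hM0 : 0 < ∫ ω, Z ω ∂μ := integral_pos_of_measure_two_le_pos hZ (by
    filter_upwards [hnat] with ω ⟨l, hl⟩
    simp [hl]) hZ2
  have hM := tsum_mul_measureReal_eq_integral hZm hnat hZ
  set M := ∫ ω, Z ω ∂μ
  set q : ℕ → ℝ := fun l => μ.real {ω | Z ω = (l : ℝ)} with hq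
  have hr : ((Real.toNNReal (β⁻¹ * M) : NNReal) : ℝ) = β⁻¹ * M :=
    Real.coe_toNNReal _ (by positivity)
  have hqM : ∑' i : ℕ, (i : ℝ) * q i = M := hM
  have hbias : ∀ j, sizeBiased q j = ((j : ℝ) + 1) * q (j + 1) / M := by
    intro j
    rw [sizeBiased, hqM, if_neg hM0.ne']
  -- the limit law and its expansions
  set π : ℕ → ℝ := fun l => μ'.real {ω | ∑ j ∈ Finset.range (Λ ω), Zt j ω = l}
  have hd : ∀ l, {ω | dstar ω = l} = {ω | ∑ j ∈ Finset.range (Λ ω), Zt j ω = l} := by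
    intro l
    simp only [hdstar]
  have hπ0 := measureReal_sum_range_poisson_zero hΛm hZtm hΛ hΛZt hZtindep hZt
  have hπrec := succ_mul_measureReal_sum_range_poisson hΛm hZtm hΛ hΛZt hZtindep hZt
  have hφ : ∀ j ≤ k, |(j.descFactorial 2 : ℝ)| ≤ (k : ℝ) * j := by
    intro j hj
    rw [Nat.abs_cast, Nat.descFactorial_succ, Nat.descFactorial_one]
    exact_mod_cast Nat.mul_le_mul_right j ((Nat.sub_le _ _).trans hj)
  have hpalm := setIntegral_sum_range_poisson hΛm hZtm hΛ hΛZt hZtindep hZt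
    (fun j => (j.descFactorial 2 : ℝ)) k hφ
  have hπk : 0 < π k := by
    rw [hd k] at hkpos
    exact ENNReal.toReal_pos hkpos.ne' (measure_ne_top _ _)
  set b : ℝ := ∫ ω in {ω | ∑ j ∈ Finset.range (Λ ω), Zt j ω = k},
    ∑ j ∈ Finset.range (Λ ω), ((Zt j ω).descFactorial 2 : ℝ) ∂μ'
  have hcond : ∫ ω, (d2star ω : ℝ) ∂(cond μ' {ω | dstar ω = k}) = (π k)⁻¹ * b := by
    rw [ProbabilityTheory.cond, integral_smul_measure, ENNReal.toReal_inv, hd k, smul_eq_mul]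
    simp only [hd2star, Nat.cast_sum]
    rfl
  -- convergence of the block laws
  have hmn' : Tendsto (fun ν => (n ν : ℝ) / m ν) atTop (𝓝 β⁻¹) :=
    (hmn.inv₀ hβ.ne').congr fun ν => inv_div _ _
  have hX3K : ∀ᶠ ν in atTop,
      ∫ x, ((x : ℕ) : ℝ) ^ 3 ∂(P ν).toMeasure ≤ ∫ ω, Z ω ^ 3 ∂μ + 1 :=
    hX3.eventually_le_const (lt_add_one _)
  have hmean := tendsto_integral_nat hXZ hX3K
  rw [hM] at hmean
  have hlam : ∀ j, Tendsto (fun ν => (n ν : ℝ) * blockLaw (m ν) (P ν) (j + 1)) atTop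
      (𝓝 ((Real.toNNReal (β⁻¹ * M) : NNReal) * sizeBiased q (j + 1))) := by
    intro j
    have h := hmn'.mul ((tendsto_measureReal_eq hXZ (j + 2)).const_mul ((j : ℝ) + 2))
    rw [hr, hbias]
    convert h using 2
    · rw [blockLaw]; ring
    · simp only [hq]
      push_cast
      field_simp
      ring_nf
  have hc : Tendsto (fun ν => (n ν : ℝ) * (1 - blockLaw (m ν) (P ν) 0)) atTop
      (𝓝 ((Real.toNNReal (β⁻¹ * M) : NNReal) * (1 - sizeBiased q 0))) := by
    have h := hmn'.mul (hmean.sub (tendsto_measureReal_eq hXZ 1))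
    rw [hr, hbias]
    convert h using 2
    · rw [blockLaw]; ring
    · simp only [hq]
      push_cast
      field_simp
      ring_nf
  have hcoeff := tendsto_coeff_mk_pow (L := atTop) (p := fun ν => blockLaw (m ν) (P ν))
    (lam := fun j => (Real.toNNReal (β⁻¹ * M) : NNReal) * sizeBiased q j) (π := π) hπ0 hπrec
  have hA0 := hcoeff k hn hc hlam
  have hB0 : Tendsto (fun ν => (n ν : ℝ) * ∑ x ∈ Finset.HasAntidiagonal.antidiagonal k,
      (x.1.descFactorial 2 : ℝ) * blockLaw (m ν) (P ν) x.1
        * PowerSeries.coeff x.2 (PowerSeries.mk (blockLaw (m ν) (P ν)) ^ (n ν - 1))) atTop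
      (𝓝 b) := by
    have h : Tendsto (fun ν => ∑ x ∈ Finset.HasAntidiagonal.antidiagonal k,
        (x.1.descFactorial 2 : ℝ) * ((n ν : ℝ) * blockLaw (m ν) (P ν) x.1)
          * PowerSeries.coeff x.2 (PowerSeries.mk (blockLaw (m ν) (P ν)) ^ (n ν - 1))) atTop
        (𝓝 (∑ x ∈ Finset.HasAntidiagonal.antidiagonal k, (x.1.descFactorial 2 : ℝ)
          * ((Real.toNNReal (β⁻¹ * M) : NNReal) * sizeBiased q x.1) * π x.2)) := by
      refine tendsto_finsetSum _ fun x _ => ?_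
      obtain ⟨j, l⟩ := x
      refine Tendsto.mul ?_ (hcoeff l ((tendsto_sub_atTop_nat 1).comp hn)
        (tendsto_pred_mul hn hc) fun j => tendsto_pred_mul hn (hlam j))
      cases j with
      | zero => simp
      | succ j => exact (hlam j).const_mul _
    rw [hpalm, Finset.mul_sum]
    convert h using 2
    · rw [Finset.mul_sum]
      exact Finset.sum_congr rfl fun x _ => by ring
    · exact Finset.sum_congr rfl fun x _ => by ring
  -- `L` lets `ν` tend to infinity uniformly in the vertex
  let L : Filter (Σ ν, Fin (m ν)) := comap Sigma.fst atTop
  have hfst : Tendsto (Sigma.fst : (Σ ν, Fin (m ν)) → ℕ) L atTop := tendsto_comap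
  have hbad0 := tendsto_overlap_bound (K := ∫ ω, Z ω ^ 3 ∂μ + 1) hβ hm hmn
  have hbad : ∀ᶠ y in L, (setsLaw (n y.1) (m y.1) (P y.1)).real
      (doubleEdge y.2 ∪ mixedTriangle y.2)
      ≤ (n y.1 : ℝ) ^ 2 * m y.1 * ((∫ ω, Z ω ^ 3 ∂μ + 1) / (m y.1 * (m y.1 - 1))) ^ 2
      + (n y.1 : ℝ) ^ 3 * (m y.1 : ℝ) ^ 2
        * ((∫ ω, Z ω ^ 3 ∂μ + 1) / (m y.1 * (m y.1 - 1))) ^ 3 := by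
    filter_upwards [hfst.eventually hX3K, hfst.eventually (hm.eventually_ge_atTop 2)] with y h1 h2
    have h2' : (2 : ℝ) ≤ m y.1 := by exact_mod_cast h2
    have hρ := measureReal_mem_mem_le (P y.1) h2 h1
    have hK0 : 0 ≤ ∫ ω, Z ω ^ 3 ∂μ + 1 := le_trans (integral_nonneg fun x => by positivity) h1
    have hρ0 : 0 ≤ (∫ ω, Z ω ^ 3 ∂μ + 1) / ((m y.1 : ℝ) * (m y.1 - 1)) :=
      div_nonneg hK0 (mul_nonneg (by linarith) (by linarith))
    exact (measureReal_union_le _ _).trans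
      (add_le_add (measureReal_doubleEdge_le _ _ hρ hρ0) (measureReal_mixedTriangle_le _ _ hρ hρ0))
  have hbadlim : Tendsto (fun y : Σ ν, Fin (m ν) => (setsLaw (n y.1) (m y.1) (P y.1)).real
      (doubleEdge y.2 ∪ mixedTriangle y.2)) L (𝓝 0) :=
    squeeze_zero' (Eventually.of_forall fun _ => measureReal_nonneg) hbad (hbad0.comp hfst)
  have hA : Tendsto (fun y : Σ ν, Fin (m ν) =>
      (setsLaw (n y.1) (m y.1) (P y.1)).real {D | degree 1 D y.2 = k}) L (𝓝 (π k)) := by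
    have h : Tendsto (fun y : Σ ν, Fin (m ν) =>
        (setsLaw (n y.1) (m y.1) (P y.1)).real {D | degree 1 D y.2 = k}
        - PowerSeries.coeff k (PowerSeries.mk (blockLaw (m y.1) (P y.1)) ^ n y.1)) L (𝓝 0) :=
      squeeze_zero_norm (fun y => (abs_measureReal_degree_sub_le (P y.1) y.2 k).trans
        (measureReal_mono Set.subset_union_left)) hbadlim
    simpa using h.add (hA0.comp hfst)
  have hB : Tendsto (fun y : Σ ν, Fin (m ν) => ∫ D in {D | degree 1 D y.2 = k},
      ((adjacentPairs D y.2).card : ℝ) ∂(setsLaw (n y.1) (m y.1) (P y.1))) L (𝓝 b) := by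
    have h : Tendsto (fun y : Σ ν, Fin (m ν) => ∫ D in {D | degree 1 D y.2 = k},
        ((adjacentPairs D y.2).card : ℝ) ∂(setsLaw (n y.1) (m y.1) (P y.1))
        - n y.1 * ∑ x ∈ Finset.HasAntidiagonal.antidiagonal k, (x.1.descFactorial 2 : ℝ)
          * blockLaw (m y.1) (P y.1) x.1
          * PowerSeries.coeff x.2 (PowerSeries.mk (blockLaw (m y.1) (P y.1)) ^ (n y.1 - 1))) L
        (𝓝 0) :=
      squeeze_zero_norm (fun y => abs_setIntegral_card_adjacentPairs_sub_le (P y.1) y.2 k)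
        (by simpa using hbadlim.const_mul ((k : ℝ) ^ 2))
    simpa using h.add (hB0.comp hfst)
  have hk' : (2 : ℝ) ≤ k := by exact_mod_cast hk
  have hkk : 0 < (k : ℝ) * (k - 1) := mul_pos (by linarith) (by linarith)
  constructor
  · have h := eventually_comap.1 (hA.eventually_const_lt hπk)
    filter_upwards [h] with ν hν w₁ w₂ w₃ h12 h13 h23
    have h1 := hν ⟨ν, w₁⟩ rfl
    have h2 := mul_measureReal_cherryEvent (n := n ν) (k := k) (P ν) h12 h13 h23
    refine pos_iff_ne_zero.2 fun h0 => ?_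
    rw [measureReal_def, h0, ENNReal.toReal_zero, mul_zero] at h2
    exact (mul_pos hkk h1).ne h2
  · intro ε hε
    have hlim := hB.div (hA.const_mul ((k : ℝ) * (k - 1))) (mul_pos hkk hπk).ne'
    have h := eventually_comap.1 ((Metric.tendsto_nhds.1 hlim) ε hε)
    filter_upwards [h] with ν hν w₁ w₂ w₃ h12 h13 h23
    have h1 := hν ⟨ν, w₁⟩ rfl
    rw [Real.dist_eq] at h1
    rw [clustering_eq (P ν) h12 h13 h23, hcond]
    have e : 1 / ((k : ℝ) * (k - 1)) * ((π k)⁻¹ * b) = b / ((k : ℝ) * (k - 1) * π k) := by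
      field_simp
    rw [e]
    exact h1
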